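/- Let $\mathbb K$ be a field. An arrangement $(\mathcal A,V)$ is a finite (possibly empty) set $\mathcal A$ of linear hyperplanes in a finite-dimensional $\mathbb K$-vector space $V$. Its lattice $L(\mathcal A)$ is the set of all intersections of subsets of $\mathcal A$ (including $V$, the empty intersection). For $X\in L(\mathcal A)$ put $\mathcal A_X=\{H\in\mathcal A : X\subseteq H\}$, and let $\mathcal A^X=\{X\cap H : H\in\mathcal A\setminus\mathcal A_X\}$, an arrangement in $X$. The product of $(\mathcal A_1,V_1)$ and $(\mathcal A_2,V_2)$ is the arrangement $\mathcal A_1\times\mathcal A_2=\{H_1\oplus V_2 : H_1\in\mathcal A_1\}\cup\{V_1\oplus H_2 : H_2\in\mathcal A_2\}$ in $V_1\oplus V_2$. A partition $\pi=(\pi_1,\dots,\pi_s)$ of $\mathcal A$ into non-empty blocks is a factorization of $\mathcal A$ if (i) for any choice of $H_i\in\pi_i$ ($1\le i\le s$) the subspace $H_1\cap\dots\cap H_s$ has codimension $s$ in $V$, and (ii) for each $X\in L(\mathcal A)\setminus\{V\}$ some $\pi_i\cap\mathcal A_X$ is a singleton. $\mathcal A$ is factored if it admits a factorization. The class of inductive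 factorizations is the smallest class of pairs $(\mathcal A,\pi)$, with $\pi$ a partition of the arrangement $\mathcal A$, such that: it contains the empty arrangement in each $V$ with the empty partition; and it contains $(\mathcal A,\pi)$ whenever there are a block of $\pi$, say $\pi_1$, and an $H_0\in\pi_1$ for which the map $\mathcal A\setminus\pi_1\to\mathcal A^{H_0}$, $H\mapsto H\cap H_0$, is a well-defined bijection and both of the following pairs are in the class: $\mathcal A\setminus\{H_0\}$ with the partition into the non-empty sets $\pi_i\setminus\{H_0\}$, and $\mathcal A^{H_0}$ with the partition into the sets $\{H\cap H_0 : H\in\pi_i\}$, $i\ne 1$. $\mathcal A$ is inductively factored if $(\mathcal A,\pi)$ is in this class for some $\pi$. $\mathcal A$ is hereditarily factored (respectively hereditarily inductively factored) if $\mathcal A^X$ is factored (respectively inductively factored) for every $X\in L(\mathcal A)$. Let $S=S(V^*)$ be the symmetric algebra of $V^*$ and $D(\mathcal A)$ the $S$-module of $\mathbb K$-derivations $\theta$ of $S$ with $\theta(\alpha)\in\alpha S$ for every $\alpha\in V^*$ with $\ker\alpha\in\mathcal A$. A derivation is homogeneous of polynomial degree $d$ if it maps $V^*$ into $S_d$.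 $\mathcal A$ is free with multiset of exponents $\exp\mathcal A$ if $D(\mathcal A)$ has a basis over $S$ consisting of homogeneous derivations; $\exp\mathcal A$ is then the multiset of their polynomial degrees, which is the same for every such basis. Let $\mathcal A_1,\mathcal A_2$ be two arrangements over $\mathbb K$ and $\mathcal A=\mathcal A_1\times\mathcal A_2$. 1. $\mathcal A$ is hereditarily factored if and only if both $\mathcal A_1$ and $\mathcal A_2$ are hereditarily factored. 2. $\mathcal A$ is hereditarily inductively factored if and only if both $\mathcal A_1$ and $\mathcal A_2$ are hereditarily inductively factored. 3. If $\mathcal A$ is inductively factored (in particular, if it is hereditarily inductively factored), then $\mathcal A_1$, $\mathcal A_2$ and $\mathcal A$ are free, and $\exp\mathcal A$ is the multiset union, with multiplicities added, of $\exp\mathcal A_1$ and $\exp\mathcal A_2$. -/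

import Mathlib

universe u v w

/-- A (central) hyperplane arrangement in the `K`-vector space `V`: a finite collection of linear
hyperplanes, i.e. of maximal proper linear subspaces of `V`. -/
structure HyperplaneArrangement (K : Type w) (V : Type u) [Field K] [AddCommGroup V]
    [Module K V] where
  /-- the hyperplanes of the arrangement -/
  hyperplanes : Set (Submodule K V)
  finite : hyperplanes.Finite
  isCoatom : ∀ H ∈ hyperplanes, IsCoatom H

/-- `P` is (the set of blocks of) a partition of the set `s`: the blocks are non-empty, pairwise
disjoint, and their union is `s`. The only partition of `∅` is the empty one. -/
structure IsPartitionOf {α : Type u} (P : Set (Set α)) (s : Set α) : Prop where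
  empty_notMem : ∅ ∉ P
  pairwiseDisjoint : P.PairwiseDisjoint id
  sUnion_eq : ⋃₀ P = s

/-- The partition induced by `P` on a subset `t`: the non-empty sets of the form `B ∩ t` with `B`
a block of `P`. -/
def inducedPartition {α : Type u} (P : Set (Set α)) (t : Set α) : Set (Set α) :=
  {C | C.Nonempty ∧ ∃ B ∈ P, C = B ∩ t}

namespace HyperplaneArrangement

section Basic

variable {K : Type w} [Field K] {V : Type u} [AddCommGroup V] [Module K V]

/-- The empty arrangement in `V`. -/
def empty (K : Type w) [Field K] (V : Type u) [AddCommGroup V] [Module K V] :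
    HyperplaneArrangement K V where
  hyperplanes := ∅
  finite := Set.finite_empty
  isCoatom := by simp

/-- The lattice `L(A)`: all intersections of subfamilies of `A`; the empty intersection is `V`. -/
def lattice (A : HyperplaneArrangement K V) : Set (Submodule K V) :=
  {X | ∃ T ⊆ A.hyperplanes, X = sInf T}

/-- The hyperplanes of the localization `A_X`: the members of `A` that contain `X`. -/
def localization (A : HyperplaneArrangement K V) (X : Submodule K V) : Set (Submodule K V) :=
  {H ∈ A.hyperplanes | X ≤ H}

/-- `X ∩ H`, as a subspace of the vector space `X`. -/
def interIn (X H : Submodule K V) : Submodule K X :=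
  H.comap X.subtype

theorem isCoatom_interIn {X H : Submodule K V} (hH : IsCoatom H) (h : ¬ X ≤ H) :
    IsCoatom (interIn X H) := by
  rcases Submodule.isCoatom_comap_or_eq_top X.subtype hH with h1 | h1
  · exact h1
  · exact absurd (Submodule.comap_subtype_eq_top.mp h1) h

/-- The restriction `A^X` of `A` to `X`: the arrangement in the vector space `X` that consists of
the `X ∩ H`, where `H` runs over the members of `A` that do not contain `X`. -/
def restriction (A : HyperplaneArrangement K V) (X : Submodule K V) :
    HyperplaneArrangement K X where
  hyperplanes := interIn X '' (A.hyperplanes \ A.localization X)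
  finite := (A.finite.subset Set.sdiff_subset).image _
  isCoatom := by
    rintro _ ⟨H, ⟨hH, hX⟩, rfl⟩
    exact isCoatom_interIn (A.isCoatom H hH) fun h => hX ⟨hH, h⟩

/-- The deletion `A' = A \ {H₀}`. -/
def deletion (A : HyperplaneArrangement K V) (H₀ : Submodule K V) :
    HyperplaneArrangement K V where
  hyperplanes := A.hyperplanes \ {H₀}
  finite := A.finite.subset Set.sdiff_subset
  isCoatom := fun H hH => A.isCoatom H hH.1

/-- The product `A₁ × A₂` in `V₁ ⊕ V₂`: the hyperplanes `H₁ ⊕ V₂` and `V₁ ⊕ H₂`. -/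
def prod {V₁ : Type u} {V₂ : Type v} [AddCommGroup V₁] [Module K V₁] [AddCommGroup V₂]
    [Module K V₂] (A₁ : HyperplaneArrangement K V₁) (A₂ : HyperplaneArrangement K V₂) :
    HyperplaneArrangement K (V₁ × V₂) where
  hyperplanes :=
    (fun H₁ : Submodule K V₁ => H₁.prod (⊤ : Submodule K V₂)) '' A₁.hyperplanes ∪
      (fun H₂ : Submodule K V₂ => (⊤ : Submodule K V₁).prod H₂) '' A₂.hyperplanes
  finite := (A₁.finite.image _).union (A₂.finite.image _)
  isCoatom := by
    rintro _ (⟨H, hH, rfl⟩ | ⟨H, hH, rfl⟩)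
    · have e : H.prod (⊤ : Submodule K V₂) = H.comap (LinearMap.fst K V₁ V₂) := by
        ext; simp
      refine (Submodule.isCoatom_comap_iff (f := LinearMap.fst K V₁ V₂)
        LinearMap.fst_surjective).mpr (A₁.isCoatom H hH) |> fun h => ?_
      simpa only [e] using h
    · have e : (⊤ : Submodule K V₁).prod H = H.comap (LinearMap.snd K V₁ V₂) := by
        ext; simp
      refine (Submodule.isCoatom_comap_iff (f := LinearMap.snd K V₁ V₂)
        LinearMap.snd_surjective).mpr (A₂.isCoatom H hH) |> fun h => ?_
      simpa only [e] using h

/-- A family `P` of sets of hyperplanes is independent: every choice of one hyperplane from each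
block meets in a subspace whose codimension is the number of blocks. -/
def Independent (P : Set (Set (Submodule K V))) : Prop :=
  ∀ c : Set (Submodule K V) → Submodule K V, (∀ B ∈ P, c B ∈ B) →
    Module.finrank K (V ⧸ ⨅ B ∈ P, c B) = P.ncard

/-- `P` is a nice partition (a factorization) of `A`. -/
structure IsFactorization (A : HyperplaneArrangement K V) (P : Set (Set (Submodule K V))) :
    Prop where
  isPartitionOf : IsPartitionOf P A.hyperplanes
  independent : Independent P
  exists_singleton : ∀ X ∈ A.lattice, X ≠ ⊤ →
    ∃ C ∈ inducedPartition P (A.localization X), ∃ H, C = {H}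

/-- `A` is factored (nice). -/
def IsFactored (A : HyperplaneArrangement K V) : Prop :=
  ∃ P, A.IsFactorization P

/-- `A` is hereditarily factored. -/
def IsHereditarilyFactored (A : HyperplaneArrangement K V) : Prop :=
  ∀ X ∈ A.lattice, (A.restriction X).IsFactored

end Basic

/-- `IsInductiveFactorization A P`: the pair `(A, P)` belongs to the class of inductively factored
arrangements, the smallest class of pairs of an arrangement and a partition of it that contains
`(∅, ∅)` in every vector space and is closed under addition of a hyperplane `H₀`. In `step`, `B₀`
is the block of `P` containing `H₀`, and the restriction map `H ↦ H ∩ H₀` from `A \ B₀` to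
`A'' = A^{H₀}` is bijective; the partition induced on `A''` has the images of the blocks other
than `B₀` as its blocks. -/
inductive IsInductiveFactorization {K : Type w} [Field K] :
    ∀ {V : Type u} [AddCommGroup V] [Module K V],
      HyperplaneArrangement K V → Set (Set (Submodule K V)) → Prop
  | empty (V : Type u) [AddCommGroup V] [Module K V] :
      IsInductiveFactorization (HyperplaneArrangement.empty K V) ∅
  | step {V : Type u} [AddCommGroup V] [Module K V] (A : HyperplaneArrangement K V)
      (P : Set (Set (Submodule K V))) (hP : IsPartitionOf P A.hyperplanes)
      (B₀ : Set (Submodule K V)) (hB₀ : B₀ ∈ P) (H₀ : Submodule K V) (hH₀ : H₀ ∈ B₀)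
      (bijective : Set.BijOn (interIn H₀) (A.hyperplanes \ B₀) (A.restriction H₀).hyperplanes)
      (deletion : IsInductiveFactorization (A.deletion H₀)
        (inducedPartition P (A.deletion H₀).hyperplanes))
      (restriction : IsInductiveFactorization (A.restriction H₀)
        ((fun B => interIn H₀ '' B) '' (P \ {B₀}))) :
      IsInductiveFactorization A P

section Inductive

variable {K : Type w} [Field K] {V : Type u} [AddCommGroup V] [Module K V]

/-- `A` is inductively factored. -/
def IsInductivelyFactored (A : HyperplaneArrangement K V) : Prop :=
  ∃ P, IsInductiveFactorization A P

/-- `A` is hereditarily inductively factored. -/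
def IsHereditarilyInductivelyFactored (A : HyperplaneArrangement K V) : Prop :=
  ∀ X ∈ A.lattice, (A.restriction X).IsInductivelyFactored

end Inductive

section Exponents

variable {K : Type w} [Field K] {V : Type u} [AddCommGroup V] [Module K V]

/-- The coordinate ring `S = S(V*)` of `V`, the symmetric algebra of the dual space. -/
abbrev CoordRing (K : Type w) (V : Type u) [Field K] [AddCommGroup V] [Module K V] :
    Type (max u w) :=
  SymmetricAlgebra K (Module.Dual K V)

/-- The homogeneous component `S_d` of `S(V*)`: the span of all products of `d` linear forms. -/
def homogeneousPart (K : Type w) (V : Type u) [Field K] [AddCommGroup V] [Module K V] (d : ℕ) :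
    Submodule K (CoordRing K V) :=
  LinearMap.range (SymmetricAlgebra.ι K (Module.Dual K V)) ^ d

/-- The `S`-module `D(A)` of `A`-derivations: the `K`-derivations `θ` of `S` such that `θ(α)` is
divisible by `α` for each linear form `α` defining a hyperplane of `A`. -/
def derivationModule (A : HyperplaneArrangement K V) :
    Submodule (CoordRing K V) (Derivation K (CoordRing K V) (CoordRing K V)) where
  carrier := {θ | ∀ H ∈ A.hyperplanes, ∀ α : Module.Dual K V, LinearMap.ker α = H →
    SymmetricAlgebra.ι K (Module.Dual K V) α ∣ θ (SymmetricAlgebra.ι K (Module.Dual K V) α)}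
  add_mem' := by
    intro θ η hθ hη H hH α hα
    simpa using dvd_add (hθ H hH α hα) (hη H hH α hα)
  zero_mem' := by
    intro H hH α hα
    simp
  smul_mem' := by
    intro f θ hθ H hH α hα
    simpa using Dvd.dvd.mul_left (hθ H hH α hα) f

/-- `θ` is homogeneous of polynomial degree `d`: it maps linear forms to `S_d`. -/
def IsHomogeneousDerivation (θ : Derivation K (CoordRing K V) (CoordRing K V)) (d : ℕ) : Prop :=
  ∀ α : Module.Dual K V, θ (SymmetricAlgebra.ι K (Module.Dual K V) α) ∈ homogeneousPart K V d

/-- `D(A)` has an `S`-basis of homogeneous derivations, the multiset of whose polynomial degrees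
is `e`. -/
def HasHomogeneousBasis (A : HyperplaneArrangement K V) (e : Multiset ℕ) : Prop :=
  ∃ (n : ℕ) (b : Module.Basis (Fin n) (CoordRing K V) A.derivationModule) (d : Fin n → ℕ),
    (∀ i, IsHomogeneousDerivation (b i : Derivation K (CoordRing K V) (CoordRing K V)) (d i)) ∧
      e = Multiset.map d Finset.univ.val

/-- `A` is free and `exp A = e`: the module `D(A)` is free with a homogeneous basis whose
polynomial degrees form the multiset `e`, and every homogeneous basis of it yields the same
multiset. -/
def IsFreeWithExponents (A : HyperplaneArrangement K V) (e : Multiset ℕ) : Prop :=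
  A.HasHomogeneousBasis e ∧ ∀ e' : Multiset ℕ, A.HasHomogeneousBasis e' → e' = e

end Exponents

end HyperplaneArrangement

/-!
A product is the case `V = V₁ × V₂` of the union of the preimages of `A₁` and `A₂` under a pair of
maps `f₁ : V → V₁`, `f₂ : V → V₂` such that `(f₁, f₂)` is surjective. The restrictions of such a
glued arrangement are again glued from restrictions of `A₁` and `A₂`, factorizations and inductive
factorizations of `A₁` and `A₂` glue, and conversely they descend along `f₁` and `f₂`. This gives
the first two parts.

Freeness follows by induction on an inductive factorization. Let `α₀` be a form with kernel `H₀` in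
the block `B₀`, and let `B` be Terao's polynomial, the product of the restrictions to `H₀` of forms
defining the members of `B₀` other than `H₀`. Because `A \ B₀` surjects onto the restriction
`A''`, `B` divides the restriction of `θ α₀` to `H₀` for every `θ` in `D(A')`, `A'` being the
deletion of `H₀`. A count of the degrees of the bases of `D(A')` and `D(A'')` yields a basis element
`b` of `D(A')` of degree at most `deg B` such that `α₀` does not divide `b α₀`; the restriction of
`b α₀` is then `B` up to a scalar. Replacing `b` by `α₀ b` and subtracting suitable multiples of `b`
from the other basis elements gives a basis of `D(A)`. Hence the exponents are the sizes of the
blocks, padded with zeros to `dim V` numbers, and these add up over a product.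
-/

section Partition

variable {α β : Type*} {P Q : Set (Set α)} {s t : Set α}

namespace IsPartitionOf

theorem subset {B : Set α} (h : IsPartitionOf P s) (hB : B ∈ P) : B ⊆ s :=
  h.sUnion_eq ▸ Set.subset_sUnion_of_mem hB

theorem nonempty {B : Set α} (h : IsPartitionOf P s) (hB : B ∈ P) : B.Nonempty :=
  Set.nonempty_iff_ne_empty.2 fun e => h.empty_notMem (e ▸ hB)

theorem eq_of_mem {B C : Set α} {a : α} (h : IsPartitionOf P s) (hB : B ∈ P) (hC : C ∈ P)
    (haB : a ∈ B) (haC : a ∈ C) : B = C :=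
  h.pairwiseDisjoint.elim_set hB hC a haB haC

theorem finite (h : IsPartitionOf P s) (hs : s.Finite) : P.Finite :=
  hs.finite_subsets.subset fun _ hB => h.subset hB

theorem disjoint (h : IsPartitionOf P s) (hst : Disjoint s (⋃₀ Q)) : Disjoint P Q := by
  refine Set.disjoint_left.2 fun B hB hB' => ?_
  obtain ⟨a, ha⟩ := h.nonempty hB
  exact Set.disjoint_left.1 hst (h.subset hB ha) ⟨B, hB', ha⟩

theorem union (hP : IsPartitionOf P s) (hQ : IsPartitionOf Q t) (hst : Disjoint s t) :
    IsPartitionOf (P ∪ Q) (s ∪ t) where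
  empty_notMem h := h.elim hP.empty_notMem hQ.empty_notMem
  pairwiseDisjoint := Set.pairwiseDisjoint_union.2
    ⟨hP.pairwiseDisjoint, hQ.pairwiseDisjoint,
      fun _ hB _ hC _ => hst.mono (hP.subset hB) (hQ.subset hC)⟩
  sUnion_eq := by rw [Set.sUnion_union, hP.sUnion_eq, hQ.sUnion_eq]

theorem image {g : α → β} (hg : Function.Injective g) (h : IsPartitionOf P s) :
    IsPartitionOf (Set.image g '' P) (g '' s) where
  empty_notMem := by
    rintro ⟨B, hB, e⟩
    exact h.empty_notMem (Set.image_eq_empty.1 e ▸ hB)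
  pairwiseDisjoint := by
    rintro _ ⟨B, hB, rfl⟩ _ ⟨C, hC, rfl⟩ hne
    exact (Set.disjoint_image_iff hg).2 (h.pairwiseDisjoint hB hC fun e => hne (e ▸ rfl))
  sUnion_eq := by rw [← Set.image_sUnion, h.sUnion_eq]

end IsPartitionOf

theorem inducedPartition_eq_self (h : IsPartitionOf P s) (hst : s ⊆ t) :
    inducedPartition P t = P := by
  have inter_eq : ∀ B ∈ P, B ∩ t = B := fun B hB => Set.inter_eq_left.2 ((h.subset hB).trans hst)
  ext C
  constructor
  · rintro ⟨-, B, hB, rfl⟩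
    rwa [inter_eq B hB]
  · exact fun hC => ⟨h.nonempty hC, C, hC, (inter_eq C hC).symm⟩

theorem inducedPartition_union (P Q : Set (Set α)) (t : Set α) :
    inducedPartition (P ∪ Q) t = inducedPartition P t ∪ inducedPartition Q t := by
  ext C
  simp only [inducedPartition, Set.mem_union, Set.mem_ofPred_eq, or_and_right, exists_or,
    and_or_left]

theorem inducedPartition_image (g : α → β) (P : Set (Set α)) (t : Set β) :
    inducedPartition (Set.image g '' P) t = Set.image g '' inducedPartition P (g ⁻¹' t) := by
  ext C
  constructor
  · rintro ⟨hne, _, ⟨B, hB, rfl⟩, rfl⟩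
    rw [← Set.image_inter_preimage] at hne ⊢
    exact ⟨_, ⟨hne.of_image, B, hB, rfl⟩, rfl⟩
  · rintro ⟨_, ⟨hne, B, hB, rfl⟩, rfl⟩
    exact ⟨hne.image g, _, ⟨B, hB, rfl⟩, Set.image_inter_preimage g B t⟩

/-- The non-empty preimages under `g` of the blocks of `P`, the partition that `P` induces along
`g`. -/
def preimagePartition (g : β → α) (P : Set (Set α)) : Set (Set β) :=
  {C | C.Nonempty ∧ ∃ B ∈ P, C = g ⁻¹' B}

theorem preimagePartition_empty (g : β → α) : preimagePartition g ∅ = ∅ := by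
  rw [Set.eq_empty_iff_forall_notMem]
  rintro _ ⟨-, B, hB, -⟩
  exact hB

theorem IsPartitionOf.preimage (g : β → α) (h : IsPartitionOf P s) :
    IsPartitionOf (preimagePartition g P) (g ⁻¹' s) where
  empty_notMem h := h.1.ne_empty rfl
  pairwiseDisjoint := by
    rintro _ ⟨-, B, hB, rfl⟩ _ ⟨-, C, hC, rfl⟩ hne
    exact (h.pairwiseDisjoint hB hC fun e => hne (congrArg _ e)).preimage g
  sUnion_eq := by
    ext b
    rw [← h.sUnion_eq]
    constructor
    · rintro ⟨_, ⟨-, B, hB, rfl⟩, hb⟩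
      exact ⟨B, hB, hb⟩
    · rintro ⟨B, hB, hb⟩
      exact ⟨g ⁻¹' B, ⟨⟨b, hb⟩, B, hB, rfl⟩, hb⟩

theorem preimagePartition_inducedPartition (g : β → α) (P : Set (Set α)) (t : Set α) :
    preimagePartition g (inducedPartition P t) =
      inducedPartition (preimagePartition g P) (g ⁻¹' t) := by
  ext C
  constructor
  · rintro ⟨hC, _, ⟨-, B, hB, rfl⟩, rfl⟩
    exact ⟨hC, g ⁻¹' B, ⟨hC.mono fun _ hx => hx.1, B, hB, rfl⟩, rfl⟩
  · rintro ⟨⟨b, hb⟩, _, ⟨-, B, hB, rfl⟩, rfl⟩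
    exact ⟨⟨b, hb⟩, B ∩ t, ⟨⟨g b, hb⟩, B, hB, rfl⟩, rfl⟩

theorem preimagePartition_eq_image (g : β → α) (P : Set (Set α)) :
    preimagePartition g P = Set.preimage g '' {B ∈ P | (g ⁻¹' B).Nonempty} := by
  ext C
  constructor
  · rintro ⟨hne, B, hB, rfl⟩
    exact ⟨B, ⟨hB, hne⟩, rfl⟩
  · rintro ⟨B, ⟨hB, hne⟩, rfl⟩
    exact ⟨hne, B, hB, rfl⟩

theorem IsPartitionOf.injOn_preimage (g : β → α) (h : IsPartitionOf P s) :
    Set.InjOn (Set.preimage g) {B ∈ P | (g ⁻¹' B).Nonempty} := by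
  rintro B ⟨hB, b, hb⟩ C ⟨hC, -⟩ e
  exact h.eq_of_mem hB hC hb (e ▸ hb : b ∈ g ⁻¹' C)

end Partition

namespace HyperplaneArrangement

variable {K : Type*} [Field K]

section Restriction

variable {V : Type*} [AddCommGroup V] [Module K V]

theorem ext_hyperplanes {A B : HyperplaneArrangement K V} (h : A.hyperplanes = B.hyperplanes) :
    A = B := by
  cases A; cases B; cases h; rfl

theorem mem_restriction {A : HyperplaneArrangement K V} {X : Submodule K V} {L : Submodule K X} :
    L ∈ (A.restriction X).hyperplanes ↔ ∃ H ∈ A.hyperplanes, ¬ X ≤ H ∧ interIn X H = L := by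
  constructor
  · rintro ⟨H, ⟨hH, hX⟩, rfl⟩
    exact ⟨H, hH, fun h => hX ⟨hH, h⟩, rfl⟩
  · rintro ⟨H, hH, hX, rfl⟩
    exact ⟨H, ⟨hH, fun h => hX h.2⟩, rfl⟩

theorem top_mem_lattice (A : HyperplaneArrangement K V) : ⊤ ∈ A.lattice :=
  ⟨∅, Set.empty_subset _, sInf_empty.symm⟩

theorem IsInductiveFactorization.isPartitionOf {A : HyperplaneArrangement K V}
    {P : Set (Set (Submodule K V))} (h : IsInductiveFactorization A P) :
    IsPartitionOf P A.hyperplanes := by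
  cases h with
  | empty => exact ⟨Set.notMem_empty _, Set.pairwiseDisjoint_empty, Set.sUnion_empty⟩
  | step _ _ hP => exact hP

end Restriction

section Descent

variable {V W : Type*} [AddCommGroup V] [Module K V] [AddCommGroup W] [Module K W]

/-- The arrangement in `W` of the hyperplanes whose preimages under the surjection `f : V → W`
belong to `A`. Along a projection it recovers a factor from a product. -/
def descent (A : HyperplaneArrangement K V) (f : V →ₗ[K] W) (hf : Function.Surjective f) :
    HyperplaneArrangement K W where
  hyperplanes := Submodule.comap f ⁻¹' A.hyperplanes
  finite := A.finite.preimage (Submodule.comap_injective_of_surjective hf).injOn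
  isCoatom := fun _ hH => (Submodule.isCoatom_comap_iff hf).1 (A.isCoatom _ hH)

/-- The map `f⁻¹(X) → X` induced by `f`, along which restrictions descend. -/
def comapRestrict (f : V →ₗ[K] W) (X : Submodule K W) : X.comap f →ₗ[K] X :=
  f.restrict fun _ hx => hx

theorem comapRestrict_surjective {f : V →ₗ[K] W} (hf : Function.Surjective f)
    (X : Submodule K W) : Function.Surjective (comapRestrict f X) := by
  rintro ⟨x, hx⟩
  obtain ⟨v, rfl⟩ := hf x
  exact ⟨⟨v, hx⟩, rfl⟩

theorem comap_comapRestrict_interIn (f : V →ₗ[K] W) (X H : Submodule K W) :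
    (interIn X H).comap (comapRestrict f X) = interIn (X.comap f) (H.comap f) := rfl

theorem exists_comap_eq_of_interIn_eq {f : V →ₗ[K] W} (hf : Function.Surjective f)
    {X : Submodule K W} {H : Submodule K V} {L : Submodule K X}
    (h : interIn (X.comap f) H = L.comap (comapRestrict f X)) :
    ∃ H' : Submodule K W, H'.comap f = H ∧ interIn X H' = L := by
  have ker_le : LinearMap.ker f ≤ H := by
    intro x hx
    have hxX : x ∈ X.comap f := LinearMap.ker_le_comap f hx
    have hxL : (⟨x, hxX⟩ : X.comap f) ∈ L.comap (comapRestrict f X) :=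
      LinearMap.ker_le_comap _ (Subtype.ext hx)
    rwa [← h] at hxL
  refine ⟨H.map f, Submodule.comap_map_eq_self ker_le, ?_⟩
  apply Submodule.comap_injective_of_surjective (comapRestrict_surjective hf X)
  rw [comap_comapRestrict_interIn, Submodule.comap_map_eq_self ker_le, h]

theorem image_interIn_preimage_comap {f : V →ₗ[K] W} (hf : Function.Surjective f)
    (X : Submodule K W) (B : Set (Submodule K V)) :
    interIn X '' (Submodule.comap f ⁻¹' B) =
      Submodule.comap (comapRestrict f X) ⁻¹' (interIn (X.comap f) '' B) := by
  ext L
  constructor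
  · rintro ⟨H, hH, rfl⟩
    exact ⟨H.comap f, hH, rfl⟩
  · rintro ⟨H, hH, e⟩
    obtain ⟨H, rfl, rfl⟩ := exists_comap_eq_of_interIn_eq hf e
    exact ⟨H, hH, rfl⟩

theorem localization_descent (A : HyperplaneArrangement K V) {f : V →ₗ[K] W}
    (hf : Function.Surjective f) (X : Submodule K W) :
    (A.descent f hf).localization X = Submodule.comap f ⁻¹' A.localization (X.comap f) :=
  Set.ext fun _ => and_congr_right' (Submodule.comap_le_comap_iff_of_surjective hf).symm

theorem restriction_descent (A : HyperplaneArrangement K V) {f : V →ₗ[K] W}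
    (hf : Function.Surjective f) (X : Submodule K W) :
    (A.descent f hf).restriction X =
      (A.restriction (X.comap f)).descent (comapRestrict f X) (comapRestrict_surjective hf X) := by
  apply ext_hyperplanes
  change interIn X '' (Submodule.comap f ⁻¹' A.hyperplanes \ (A.descent f hf).localization X) = _
  rw [localization_descent, ← Set.preimage_sdiff, image_interIn_preimage_comap hf]
  rfl

theorem deletion_descent (A : HyperplaneArrangement K V) {f : V →ₗ[K] W}
    (hf : Function.Surjective f) (H₀ : Submodule K W) :
    (A.descent f hf).deletion H₀ = (A.deletion (H₀.comap f)).descent f hf :=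
  ext_hyperplanes <| Set.ext fun _ => and_congr_right' <|
    (Submodule.comap_injective_of_surjective hf).ne_iff.symm

theorem deletion_descent_of_notMem_range (A : HyperplaneArrangement K V) {f : V →ₗ[K] W}
    (hf : Function.Surjective f) {H₀ : Submodule K V}
    (hH₀ : H₀ ∉ Set.range (Submodule.comap f)) :
    (A.deletion H₀).descent f hf = A.descent f hf :=
  ext_hyperplanes <| Set.ext fun H => and_iff_left fun e => hH₀ ⟨H, e⟩

theorem bijOn_interIn_descent {A : HyperplaneArrangement K V} {B₀ : Set (Submodule K V)}
    {f : V →ₗ[K] W} (hf : Function.Surjective f) {H₀ : Submodule K W}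
    (h : Set.BijOn (interIn (H₀.comap f)) (A.hyperplanes \ B₀)
      (A.restriction (H₀.comap f)).hyperplanes) :
    Set.BijOn (interIn H₀) ((A.descent f hf).hyperplanes \ Submodule.comap f ⁻¹' B₀)
      ((A.descent f hf).restriction H₀).hyperplanes := by
  have inj : Set.InjOn (interIn H₀) (Submodule.comap f ⁻¹' (A.hyperplanes \ B₀)) := by
    intro H hH H' hH' e
    apply Submodule.comap_injective_of_surjective hf
    apply h.injOn hH hH'
    rw [← comap_comapRestrict_interIn, ← comap_comapRestrict_interIn, e]
  rw [restriction_descent]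
  change Set.BijOn (interIn H₀) (Submodule.comap f ⁻¹' (A.hyperplanes \ B₀))
    (Submodule.comap (comapRestrict f H₀) ⁻¹' (A.restriction (H₀.comap f)).hyperplanes)
  rw [← h.image_eq, ← image_interIn_preimage_comap hf]
  exact inj.bijOn_image

theorem restriction_preimagePartition {s : Set (Submodule K V)} {P : Set (Set (Submodule K V))}
    {B₀ : Set (Submodule K V)} {f : V →ₗ[K] W} (hf : Function.Surjective f) (X : Submodule K W)
    (hP : IsPartitionOf P s) (hB₀ : B₀ ∈ P) :
    Set.image (interIn X) '' (preimagePartition (Submodule.comap f) P \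
        {Submodule.comap f ⁻¹' B₀}) =
      preimagePartition (Submodule.comap (comapRestrict f X))
        (Set.image (interIn (X.comap f)) '' (P \ {B₀})) := by
  ext C
  constructor
  · rintro ⟨_, ⟨⟨hne, B, hB, rfl⟩, hBB⟩, rfl⟩
    exact ⟨hne.image _, _, ⟨B, ⟨hB, fun h => hBB (congrArg _ h)⟩, rfl⟩,
      image_interIn_preimage_comap hf X B⟩
  · rintro ⟨hne, _, ⟨B, ⟨hB, hBB⟩, rfl⟩, rfl⟩
    rw [← image_interIn_preimage_comap hf, Set.image_nonempty] at hne
    refine ⟨_, ⟨⟨hne, B, hB, rfl⟩, fun h => hBB ?_⟩, image_interIn_preimage_comap hf X B⟩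
    obtain ⟨L, hL⟩ := hne
    have hL₀ : L ∈ Submodule.comap f ⁻¹' B₀ := Set.mem_singleton_iff.1 h ▸ hL
    exact hP.eq_of_mem hB hB₀ hL hL₀

theorem IsInductiveFactorization.descent {A : HyperplaneArrangement K V}
    {P : Set (Set (Submodule K V))} (h : IsInductiveFactorization A P) :
    ∀ {W : Type*} [AddCommGroup W] [Module K W] (f : V →ₗ[K] W) (hf : Function.Surjective f),
      IsInductiveFactorization (A.descent f hf) (preimagePartition (Submodule.comap f) P) := by
  induction h with
  | empty V =>
    intro W _ _ f hf
    convert IsInductiveFactorization.empty W using 1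
    · exact ext_hyperplanes rfl
    · exact preimagePartition_empty _
  | step A P hP B₀ hB₀ H₀ hH₀ bijective _ _ deletion_descends restriction_descends =>
    intro W _ _ f hf
    have hP' : IsPartitionOf (preimagePartition (Submodule.comap f) P)
      (A.descent f hf).hyperplanes := hP.preimage _
    by_cases hrange : H₀ ∈ Set.range (Submodule.comap f)
    · obtain ⟨H₀, rfl⟩ := hrange
      refine .step _ _ hP' (Submodule.comap f ⁻¹' B₀) ⟨⟨H₀, hH₀⟩, B₀, hB₀, rfl⟩ H₀ hH₀
        (bijOn_interIn_descent hf bijective) ?_ ?_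
      · rw [deletion_descent]
        convert deletion_descends f hf using 1
        exact (preimagePartition_inducedPartition _ _ _).symm
      · rw [restriction_descent]
        convert restriction_descends _ _ using 1
        exact restriction_preimagePartition hf H₀ hP hB₀
    · have hdel := deletion_descent_of_notMem_range A hf hrange
      convert deletion_descends f hf using 1
      · exact hdel.symm
      · rw [preimagePartition_inducedPartition]
        exact (inducedPartition_eq_self hP' (congrArg hyperplanes hdel).ge).symm

end Descent

section Glue

variable {V : Type u} {V₁ V₂ : Type*} [AddCommGroup V] [Module K V] [AddCommGroup V₁] [Module K V₁]
  [AddCommGroup V₂] [Module K V₂]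

/-- The arrangement in `V` of the preimages of the hyperplanes of `A` under the surjection
`f : V → W`. -/
def pullback {W : Type*} [AddCommGroup W] [Module K W] (A : HyperplaneArrangement K W)
    (f : V →ₗ[K] W) (hf : Function.Surjective f) : HyperplaneArrangement K V where
  hyperplanes := Submodule.comap f '' A.hyperplanes
  finite := A.finite.image _
  isCoatom := by
    rintro _ ⟨H, hH, rfl⟩
    exact (Submodule.isCoatom_comap_iff hf).2 (A.isCoatom H hH)

theorem exists_of_surjective_prod {f₁ : V →ₗ[K] V₁} {f₂ : V →ₗ[K] V₂}
    (hf : Function.Surjective (f₁.prod f₂)) (x₁ : V₁) (x₂ : V₂) : ∃ v, f₁ v = x₁ ∧ f₂ v = x₂ := by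
  obtain ⟨v, hv⟩ := hf (x₁, x₂)
  exact ⟨v, congrArg Prod.fst hv, congrArg Prod.snd hv⟩

theorem surjective_fst_of_prod {f₁ : V →ₗ[K] V₁} {f₂ : V →ₗ[K] V₂}
    (hf : Function.Surjective (f₁.prod f₂)) : Function.Surjective f₁ := fun x =>
  (exists_of_surjective_prod hf x 0).imp fun _ => And.left

theorem surjective_snd_of_prod {f₁ : V →ₗ[K] V₁} {f₂ : V →ₗ[K] V₂}
    (hf : Function.Surjective (f₁.prod f₂)) : Function.Surjective f₂ := fun x =>
  (exists_of_surjective_prod hf 0 x).imp fun _ => And.right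

theorem surjective_prod_swap {f₁ : V →ₗ[K] V₁} {f₂ : V →ₗ[K] V₂}
    (hf : Function.Surjective (f₁.prod f₂)) : Function.Surjective (f₂.prod f₁) :=
  fun ⟨x, y⟩ => (exists_of_surjective_prod hf y x).imp fun _ h => Prod.ext h.2 h.1

theorem comap_fst_injective {f₁ : V →ₗ[K] V₁} {f₂ : V →ₗ[K] V₂}
    (hf : Function.Surjective (f₁.prod f₂)) : Function.Injective (Submodule.comap f₁) :=
  Submodule.comap_injective_of_surjective (surjective_fst_of_prod hf)

theorem comap_snd_injective {f₁ : V →ₗ[K] V₁} {f₂ : V →ₗ[K] V₂}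
    (hf : Function.Surjective (f₁.prod f₂)) : Function.Injective (Submodule.comap f₂) :=
  Submodule.comap_injective_of_surjective (surjective_snd_of_prod hf)

theorem inf_comap_le_comap_fst_iff {f₁ : V →ₗ[K] V₁} {f₂ : V →ₗ[K] V₂}
    (hf : Function.Surjective (f₁.prod f₂)) {X₁ H : Submodule K V₁} {X₂ : Submodule K V₂} :
    X₁.comap f₁ ⊓ X₂.comap f₂ ≤ H.comap f₁ ↔ X₁ ≤ H := by
  refine ⟨fun h x hx => ?_, fun h => inf_le_left.trans (Submodule.comap_mono h)⟩
  obtain ⟨v, rfl, h0⟩ := exists_of_surjective_prod hf x 0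
  exact h ⟨hx, by simp [h0]⟩

theorem inf_comap_le_comap_snd_iff {f₁ : V →ₗ[K] V₁} {f₂ : V →ₗ[K] V₂}
    (hf : Function.Surjective (f₁.prod f₂)) {X₁ : Submodule K V₁} {X₂ H : Submodule K V₂} :
    X₁.comap f₁ ⊓ X₂.comap f₂ ≤ H.comap f₂ ↔ X₂ ≤ H := by
  rw [inf_comm, inf_comap_le_comap_fst_iff (surjective_prod_swap hf)]

theorem not_comap_fst_le_comap_snd {f₁ : V →ₗ[K] V₁} {f₂ : V →ₗ[K] V₂}
    (hf : Function.Surjective (f₁.prod f₂)) (X : Submodule K V₁) {H : Submodule K V₂}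
    (hH : H ≠ ⊤) : ¬ X.comap f₁ ≤ H.comap f₂ := fun h =>
  hH <| top_le_iff.1 <| (inf_comap_le_comap_snd_iff hf).1 (inf_le_left.trans h)

/-- The union of the preimages of `A₁` and `A₂` under a jointly surjective pair of maps. Up to
isomorphism this is `A₁ × A₂` together with the intersection of the kernels as an additional
direct summand of the ambient space; unlike products on the nose, such arrangements are closed
under restriction. -/
def glue (A₁ : HyperplaneArrangement K V₁) (A₂ : HyperplaneArrangement K V₂)
    (f₁ : V →ₗ[K] V₁) (f₂ : V →ₗ[K] V₂) (hf : Function.Surjective (f₁.prod f₂)) :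
    HyperplaneArrangement K V where
  hyperplanes := Submodule.comap f₁ '' A₁.hyperplanes ∪ Submodule.comap f₂ '' A₂.hyperplanes
  finite := (A₁.finite.image _).union (A₂.finite.image _)
  isCoatom := by
    rintro H (hH | hH)
    · exact (A₁.pullback f₁ (surjective_fst_of_prod hf)).isCoatom H hH
    · exact (A₂.pullback f₂ (surjective_snd_of_prod hf)).isCoatom H hH

/-- The partition of a glued arrangement into the preimages of the blocks of `P₁` and `P₂`. -/
def gluePartition (P₁ : Set (Set (Submodule K V₁))) (P₂ : Set (Set (Submodule K V₂)))
    (f₁ : V →ₗ[K] V₁) (f₂ : V →ₗ[K] V₂) : Set (Set (Submodule K V)) :=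
  Set.image (Submodule.comap f₁) '' P₁ ∪ Set.image (Submodule.comap f₂) '' P₂

theorem surjective_fst_prod_snd (K V₁ V₂ : Type*) [Field K] [AddCommGroup V₁] [Module K V₁]
    [AddCommGroup V₂] [Module K V₂] :
    Function.Surjective ((LinearMap.fst K V₁ V₂).prod (LinearMap.snd K V₁ V₂)) :=
  Function.surjective_id

theorem prod_eq_glue (A₁ : HyperplaneArrangement K V₁) (A₂ : HyperplaneArrangement K V₂) :
    A₁.prod A₂ = A₁.glue A₂ (LinearMap.fst K V₁ V₂) (LinearMap.snd K V₁ V₂)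
      (surjective_fst_prod_snd K V₁ V₂) := by
  apply ext_hyperplanes
  have prod_top (H : Submodule K V₁) : H.prod (⊤ : Submodule K V₂) =
      H.comap (LinearMap.fst K V₁ V₂) := by
    ext; simp
  have top_prod (H : Submodule K V₂) : (⊤ : Submodule K V₁).prod H =
      H.comap (LinearMap.snd K V₁ V₂) := by
    ext; simp
  simp only [prod, glue, prod_top, top_prod]

theorem glue_comm (A₁ : HyperplaneArrangement K V₁) (A₂ : HyperplaneArrangement K V₂)
    {f₁ : V →ₗ[K] V₁} {f₂ : V →ₗ[K] V₂} (hf : Function.Surjective (f₁.prod f₂)) :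
    A₁.glue A₂ f₁ f₂ hf = A₂.glue A₁ f₂ f₁ (surjective_prod_swap hf) :=
  ext_hyperplanes (Set.union_comm _ _)

theorem gluePartition_comm (P₁ : Set (Set (Submodule K V₁))) (P₂ : Set (Set (Submodule K V₂)))
    (f₁ : V →ₗ[K] V₁) (f₂ : V →ₗ[K] V₂) :
    gluePartition P₁ P₂ f₁ f₂ = gluePartition P₂ P₁ f₂ f₁ :=
  Set.union_comm _ _

variable {A₁ : HyperplaneArrangement K V₁} {A₂ : HyperplaneArrangement K V₂}
  {P₁ : Set (Set (Submodule K V₁))} {P₂ : Set (Set (Submodule K V₂))}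
  {f₁ : V →ₗ[K] V₁} {f₂ : V →ₗ[K] V₂}

theorem comap_fst_ne_comap_snd (hf : Function.Surjective (f₁.prod f₂)) (X : Submodule K V₁)
    {H : Submodule K V₂} (hH : H ∈ A₂.hyperplanes) : X.comap f₁ ≠ H.comap f₂ := fun h =>
  not_comap_fst_le_comap_snd hf X (A₂.isCoatom H hH).1 h.le

theorem disjoint_image_comap (hf : Function.Surjective (f₁.prod f₂)) (s : Set (Submodule K V₁)) :
    Disjoint (Submodule.comap f₁ '' s) (Submodule.comap f₂ '' A₂.hyperplanes) := by
  rw [Set.disjoint_left]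
  rintro _ ⟨X, -, rfl⟩ ⟨H, hH, e⟩
  exact comap_fst_ne_comap_snd hf X hH e.symm

theorem isPartitionOf_glue (hf : Function.Surjective (f₁.prod f₂))
    (h₁ : IsPartitionOf P₁ A₁.hyperplanes) (h₂ : IsPartitionOf P₂ A₂.hyperplanes) :
    IsPartitionOf (gluePartition P₁ P₂ f₁ f₂) (A₁.glue A₂ f₁ f₂ hf).hyperplanes :=
  (h₁.image (comap_fst_injective hf)).union (h₂.image (comap_snd_injective hf))
    (disjoint_image_comap hf _)

theorem disjoint_image_partition (hf : Function.Surjective (f₁.prod f₂))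
    (P₁ : Set (Set (Submodule K V₁))) (h₂ : IsPartitionOf P₂ A₂.hyperplanes) :
    Disjoint (Set.image (Submodule.comap f₁) '' P₁) (Set.image (Submodule.comap f₂) '' P₂) := by
  refine ((h₂.image (comap_snd_injective hf)).disjoint ?_).symm
  rw [← Set.image_sUnion]
  exact (disjoint_image_comap hf _).symm

theorem ncard_gluePartition (hf : Function.Surjective (f₁.prod f₂))
    (h₁ : IsPartitionOf P₁ A₁.hyperplanes) (h₂ : IsPartitionOf P₂ A₂.hyperplanes) :
    (gluePartition P₁ P₂ f₁ f₂).ncard = P₁.ncard + P₂.ncard := by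
  rw [gluePartition, Set.ncard_union_eq (disjoint_image_partition hf P₁ h₂)
      ((h₁.finite A₁.finite).image _) ((h₂.finite A₂.finite).image _),
    Set.ncard_image_of_injective _ (Set.image_injective.2 (comap_fst_injective hf)),
    Set.ncard_image_of_injective _ (Set.image_injective.2 (comap_snd_injective hf))]

theorem inducedPartition_gluePartition (P₁ : Set (Set (Submodule K V₁)))
    (P₂ : Set (Set (Submodule K V₂))) (f₁ : V →ₗ[K] V₁) (f₂ : V →ₗ[K] V₂)
    (t : Set (Submodule K V)) :
    inducedPartition (gluePartition P₁ P₂ f₁ f₂) t =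
      gluePartition (inducedPartition P₁ (Submodule.comap f₁ ⁻¹' t))
        (inducedPartition P₂ (Submodule.comap f₂ ⁻¹' t)) f₁ f₂ := by
  rw [gluePartition, inducedPartition_union, inducedPartition_image, inducedPartition_image,
    gluePartition]

theorem descent_glue (A₁ : HyperplaneArrangement K V₁) (A₂ : HyperplaneArrangement K V₂)
    (hf : Function.Surjective (f₁.prod f₂)) :
    (A₁.glue A₂ f₁ f₂ hf).descent f₁ (surjective_fst_of_prod hf) = A₁ := by
  apply ext_hyperplanes
  ext H
  constructor
  · rintro (⟨H', hH, e⟩ | ⟨H', hH, e⟩)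
    · exact comap_fst_injective hf e ▸ hH
    · exact (comap_fst_ne_comap_snd hf H hH e.symm).elim
  · exact fun hH => Or.inl ⟨H, hH, rfl⟩

theorem glue_deletion (A₁ : HyperplaneArrangement K V₁) (A₂ : HyperplaneArrangement K V₂)
    (hf : Function.Surjective (f₁.prod f₂)) (H₀ : Submodule K V₁) :
    (A₁.glue A₂ f₁ f₂ hf).deletion (H₀.comap f₁) = (A₁.deletion H₀).glue A₂ f₁ f₂ hf := by
  apply ext_hyperplanes
  change (_ ∪ _) \ {H₀.comap f₁} = Submodule.comap f₁ '' (A₁.hyperplanes \ {H₀}) ∪ _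
  rw [Set.union_sdiff_distrib, Set.image_sdiff (comap_fst_injective hf), Set.image_singleton]
  congr 1
  rw [sdiff_eq_left, ← Set.image_singleton]
  exact (disjoint_image_comap hf _).symm

theorem inducedPartition_deletion_glue (hf : Function.Surjective (f₁.prod f₂))
    (H₀ : Submodule K V₁) (P₁ : Set (Set (Submodule K V₁)))
    (h₂ : IsPartitionOf P₂ A₂.hyperplanes) :
    inducedPartition (gluePartition P₁ P₂ f₁ f₂)
        ((A₁.deletion H₀).glue A₂ f₁ f₂ hf).hyperplanes =
      gluePartition (inducedPartition P₁ (A₁.deletion H₀).hyperplanes) P₂ f₁ f₂ := by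
  have preimage_fst := congrArg hyperplanes (descent_glue (A₁.deletion H₀) A₂ hf)
  rw [inducedPartition_gluePartition]
  congr 1
  · exact congrArg _ preimage_fst
  · exact inducedPartition_eq_self h₂ fun H hH => Or.inr ⟨H, hH, rfl⟩

theorem surjective_comapRestrict_prod (hf : Function.Surjective (f₁.prod f₂))
    (X : Submodule K V₁) :
    Function.Surjective ((comapRestrict f₁ X).prod (f₂ ∘ₗ (X.comap f₁).subtype)) := by
  rintro ⟨⟨x, hx⟩, y⟩
  obtain ⟨v, rfl, rfl⟩ := exists_of_surjective_prod hf x y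
  exact ⟨⟨v, hx⟩, rfl⟩

theorem restriction_comap_glue (A₁ : HyperplaneArrangement K V₁)
    (A₂ : HyperplaneArrangement K V₂) (hf : Function.Surjective (f₁.prod f₂))
    (X : Submodule K V₁) :
    (A₁.glue A₂ f₁ f₂ hf).restriction (X.comap f₁) =
      (A₁.restriction X).glue A₂ (comapRestrict f₁ X) (f₂ ∘ₗ (X.comap f₁).subtype)
        (surjective_comapRestrict_prod hf X) := by
  apply ext_hyperplanes
  ext L
  rw [mem_restriction]
  constructor
  · rintro ⟨_, ⟨H, hH, rfl⟩ | ⟨H, hH, rfl⟩, hX, rfl⟩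
    · exact Or.inl ⟨interIn X H,
        mem_restriction.2 ⟨H, hH, fun h => hX (Submodule.comap_mono h), rfl⟩, rfl⟩
    · exact Or.inr ⟨H, hH, rfl⟩
  · rintro (⟨L, hL, rfl⟩ | ⟨H, hH, rfl⟩)
    · obtain ⟨H, hH, hX, rfl⟩ := mem_restriction.1 hL
      exact ⟨H.comap f₁, Or.inl ⟨H, hH, rfl⟩, fun h => hX
        ((Submodule.comap_le_comap_iff_of_surjective (surjective_fst_of_prod hf)).1 h), rfl⟩
    · exact ⟨H.comap f₂, Or.inr ⟨H, hH, rfl⟩,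
        not_comap_fst_le_comap_snd hf X (A₂.isCoatom _ hH).1, rfl⟩

theorem surjective_restrict_prod (hf : Function.Surjective (f₁.prod f₂)) (X₁ : Submodule K V₁)
    (X₂ : Submodule K V₂) :
    Function.Surjective
      ((f₁.restrict (p := X₁.comap f₁ ⊓ X₂.comap f₂) (q := X₁) fun _ h => h.1).prod
        (f₂.restrict (p := X₁.comap f₁ ⊓ X₂.comap f₂) (q := X₂) fun _ h => h.2)) := by
  rintro ⟨⟨x, hx⟩, y, hy⟩
  obtain ⟨v, rfl, rfl⟩ := exists_of_surjective_prod hf x y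
  exact ⟨⟨v, hx, hy⟩, rfl⟩

theorem restriction_inf_glue (A₁ : HyperplaneArrangement K V₁) (A₂ : HyperplaneArrangement K V₂)
    (hf : Function.Surjective (f₁.prod f₂)) (X₁ : Submodule K V₁) (X₂ : Submodule K V₂) :
    (A₁.glue A₂ f₁ f₂ hf).restriction (X₁.comap f₁ ⊓ X₂.comap f₂) =
      (A₁.restriction X₁).glue (A₂.restriction X₂) _ _ (surjective_restrict_prod hf X₁ X₂) := by
  apply ext_hyperplanes
  ext L
  rw [mem_restriction]
  constructor
  · rintro ⟨_, ⟨H, hH, rfl⟩ | ⟨H, hH, rfl⟩, hX, rfl⟩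
    · exact Or.inl ⟨interIn X₁ H, mem_restriction.2
        ⟨H, hH, fun h => hX ((inf_comap_le_comap_fst_iff hf).2 h), rfl⟩, rfl⟩
    · exact Or.inr ⟨interIn X₂ H, mem_restriction.2
        ⟨H, hH, fun h => hX ((inf_comap_le_comap_snd_iff hf).2 h), rfl⟩, rfl⟩
  · rintro (⟨L, hL, rfl⟩ | ⟨L, hL, rfl⟩) <;> obtain ⟨H, hH, hX, rfl⟩ := mem_restriction.1 hL
    · exact ⟨H.comap f₁, Or.inl ⟨H, hH, rfl⟩,
        fun h => hX ((inf_comap_le_comap_fst_iff hf).1 h), rfl⟩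
    · exact ⟨H.comap f₂, Or.inr ⟨H, hH, rfl⟩,
        fun h => hX ((inf_comap_le_comap_snd_iff hf).1 h), rfl⟩

theorem mem_lattice_glue (hf : Function.Surjective (f₁.prod f₂)) {X : Submodule K V} :
    X ∈ (A₁.glue A₂ f₁ f₂ hf).lattice ↔
      ∃ X₁ ∈ A₁.lattice, ∃ X₂ ∈ A₂.lattice, X = X₁.comap f₁ ⊓ X₂.comap f₂ := by
  constructor
  · rintro ⟨T, hT, rfl⟩
    refine ⟨_, ⟨{H ∈ A₁.hyperplanes | H.comap f₁ ∈ T}, fun _ h => h.1, rfl⟩,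
      _, ⟨{H ∈ A₂.hyperplanes | H.comap f₂ ∈ T}, fun _ h => h.1, rfl⟩, le_antisymm ?_ ?_⟩
    · simp only [sInf_eq_iInf, Submodule.comap_iInf]
      exact le_inf (le_iInf₂ fun H hH => iInf₂_le _ hH.2) (le_iInf₂ fun H hH => iInf₂_le _ hH.2)
    · refine le_sInf fun H hH => ?_
      rcases hT hH with ⟨H, hA, rfl⟩ | ⟨H, hA, rfl⟩
      · exact inf_le_left.trans (Submodule.comap_mono (sInf_le ⟨hA, hH⟩))
      · exact inf_le_right.trans (Submodule.comap_mono (sInf_le ⟨hA, hH⟩))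
  · rintro ⟨_, ⟨T₁, hT₁, rfl⟩, _, ⟨T₂, hT₂, rfl⟩, rfl⟩
    refine ⟨Submodule.comap f₁ '' T₁ ∪ Submodule.comap f₂ '' T₂,
      Set.union_subset_union (Set.image_mono hT₁) (Set.image_mono hT₂), ?_⟩
    rw [sInf_union, sInf_image, sInf_image]
    simp only [sInf_eq_iInf, Submodule.comap_iInf]

theorem forall_mem_lattice_glue_iff (hf : Function.Surjective (f₁.prod f₂))
    {p : Submodule K V → Prop} {p₁ : Submodule K V₁ → Prop} {p₂ : Submodule K V₂ → Prop}
    (h : ∀ X₁ X₂, p (X₁.comap f₁ ⊓ X₂.comap f₂) ↔ p₁ X₁ ∧ p₂ X₂) :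
    (∀ X ∈ (A₁.glue A₂ f₁ f₂ hf).lattice, p X) ↔
      (∀ X ∈ A₁.lattice, p₁ X) ∧ ∀ X ∈ A₂.lattice, p₂ X := by
  constructor
  · intro hp
    have hp' : ∀ X₁ ∈ A₁.lattice, ∀ X₂ ∈ A₂.lattice, p₁ X₁ ∧ p₂ X₂ := fun X₁ h₁ X₂ h₂ =>
      (h X₁ X₂).1 (hp _ ((mem_lattice_glue hf).2 ⟨X₁, h₁, X₂, h₂, rfl⟩))
    exact ⟨fun X hX => (hp' X hX ⊤ A₂.top_mem_lattice).1,
      fun X hX => (hp' ⊤ A₁.top_mem_lattice X hX).2⟩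
  · rintro ⟨hp₁, hp₂⟩ X hX
    obtain ⟨X₁, h₁, X₂, h₂, rfl⟩ := (mem_lattice_glue hf).1 hX
    exact (h X₁ X₂).2 ⟨hp₁ X₁ h₁, hp₂ X₂ h₂⟩

theorem bijOn_interIn_glue (hf : Function.Surjective (f₁.prod f₂)) {H₀ : Submodule K V₁}
    {B₀ : Set (Submodule K V₁)}
    (h : Set.BijOn (interIn H₀) (A₁.hyperplanes \ B₀) (A₁.restriction H₀).hyperplanes) :
    Set.BijOn (interIn (H₀.comap f₁))
      ((A₁.glue A₂ f₁ f₂ hf).hyperplanes \ Submodule.comap f₁ '' B₀)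
      ((A₁.glue A₂ f₁ f₂ hf).restriction (H₀.comap f₁)).hyperplanes := by
  have hg := surjective_comapRestrict_prod hf H₀
  have domain_eq : (A₁.glue A₂ f₁ f₂ hf).hyperplanes \ Submodule.comap f₁ '' B₀ =
      Submodule.comap f₁ '' (A₁.hyperplanes \ B₀) ∪ Submodule.comap f₂ '' A₂.hyperplanes := by
    rw [Set.image_sdiff (comap_fst_injective hf), glue, Set.union_sdiff_distrib]
    congr 1
    exact sdiff_eq_left.2 (disjoint_image_comap hf _).symm
  rw [domain_eq, restriction_comap_glue]
  change Set.BijOn _ _ (Submodule.comap (comapRestrict f₁ H₀) '' (A₁.restriction H₀).hyperplanes ∪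
    Submodule.comap (f₂ ∘ₗ (H₀.comap f₁).subtype) '' A₂.hyperplanes)
  rw [← h.image_eq, Set.image_image]
  have injOn : Set.InjOn (interIn (H₀.comap f₁))
      (Submodule.comap f₁ '' (A₁.hyperplanes \ B₀) ∪ Submodule.comap f₂ '' A₂.hyperplanes) := by
    rw [Set.injOn_union (disjoint_image_comap hf _)]
    refine ⟨Set.InjOn.image_of_comp ((comap_fst_injective hg).injOn.comp h.injOn
        (Set.mapsTo_univ _ _)), Set.InjOn.image_of_comp (comap_snd_injective hg).injOn, ?_⟩
    rintro _ ⟨H, -, rfl⟩ _ ⟨H', hH', rfl⟩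
    exact comap_fst_ne_comap_snd hg (interIn H₀ H) hH'
  convert injOn.bijOn_image using 1
  rw [Set.image_union, Set.image_image, Set.image_image]
  rfl

theorem restriction_gluePartition (hf : Function.Surjective (f₁.prod f₂)) (X : Submodule K V₁)
    (P₁ : Set (Set (Submodule K V₁))) (h₂ : IsPartitionOf P₂ A₂.hyperplanes)
    (B₀ : Set (Submodule K V₁)) :
    Set.image (interIn (X.comap f₁)) ''
        (gluePartition P₁ P₂ f₁ f₂ \ {Submodule.comap f₁ '' B₀}) =
      gluePartition (Set.image (interIn X) '' (P₁ \ {B₀})) P₂ (comapRestrict f₁ X)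
        (f₂ ∘ₗ (X.comap f₁).subtype) := by
  have sdiff_eq : gluePartition P₁ P₂ f₁ f₂ \ {Submodule.comap f₁ '' B₀} =
      gluePartition (P₁ \ {B₀}) P₂ f₁ f₂ := by
    rw [gluePartition, gluePartition, Set.union_sdiff_distrib,
      Set.image_sdiff (Set.image_injective.2 (comap_fst_injective hf)), Set.image_singleton]
    congr 1
    rw [sdiff_eq_left, ← Set.image_singleton]
    exact (disjoint_image_partition hf _ h₂).symm
  rw [sdiff_eq, gluePartition, gluePartition, Set.image_union]
  simp only [Set.image_image]
  rfl

theorem IsInductiveFactorization.glue_of_pullback (h₁ : IsInductiveFactorization A₁ P₁)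
    (h₂ : IsPartitionOf P₂ A₂.hyperplanes)
    (pullback_factors : ∀ {V : Type u} [AddCommGroup V] [Module K V] (f : V →ₗ[K] V₂)
      (hf : Function.Surjective f),
      IsInductiveFactorization (A₂.pullback f hf) (Set.image (Submodule.comap f) '' P₂)) :
    ∀ {V : Type u} [AddCommGroup V] [Module K V] (f₁ : V →ₗ[K] V₁) (f₂ : V →ₗ[K] V₂)
      (hf : Function.Surjective (f₁.prod f₂)),
      IsInductiveFactorization (A₁.glue A₂ f₁ f₂ hf) (gluePartition P₁ P₂ f₁ f₂) := by
  induction h₁ with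
  | empty V₁ =>
    intro V _ _ f₁ f₂ hf
    convert pullback_factors f₂ (surjective_snd_of_prod hf) using 1
    · apply ext_hyperplanes
      simp only [glue, pullback, HyperplaneArrangement.empty, Set.image_empty, Set.empty_union]
    · rw [gluePartition, Set.image_empty, Set.empty_union]
  | step A₁ P₁ hP₁ B₀ hB₀ H₀ hH₀ bijective _ _ glue_deletion glue_restriction =>
    intro V _ _ f₁ f₂ hf
    refine .step _ _ (isPartitionOf_glue hf hP₁ h₂) (Submodule.comap f₁ '' B₀)
      (Or.inl ⟨B₀, hB₀, rfl⟩) (H₀.comap f₁) ⟨H₀, hH₀, rfl⟩ (bijOn_interIn_glue hf bijective) ?_ ?_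
    · rw [HyperplaneArrangement.glue_deletion, inducedPartition_deletion_glue hf H₀ P₁ h₂]
      exact glue_deletion f₁ f₂ hf
    · rw [restriction_comap_glue]
      convert glue_restriction _ _ (surjective_comapRestrict_prod hf H₀) using 1
      exact restriction_gluePartition hf H₀ P₁ h₂ B₀

theorem IsInductiveFactorization.pullback (h₂ : IsInductiveFactorization A₂ P₂)
    (f : V →ₗ[K] V₂) (hf : Function.Surjective f) :
    IsInductiveFactorization (A₂.pullback f hf) (Set.image (Submodule.comap f) '' P₂) := by
  have hg : Function.Surjective (f.prod (0 : V →ₗ[K] PUnit.{1})) := fun ⟨x, _⟩ =>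
    (hf x).imp fun _ h => Prod.ext h rfl
  have hempty : IsInductiveFactorization (HyperplaneArrangement.empty K PUnit.{1}) ∅ := .empty _
  convert h₂.glue_of_pullback hempty.isPartitionOf (fun {V} _ _ f hf => ?_) f 0 hg using 1
  · apply ext_hyperplanes
    simp only [glue, HyperplaneArrangement.pullback, HyperplaneArrangement.empty, Set.image_empty,
      Set.union_empty]
  · rw [gluePartition, Set.image_empty, Set.union_empty]
  · convert IsInductiveFactorization.empty V using 1
    · exact ext_hyperplanes (Set.image_empty _)
    · exact Set.image_empty _

theorem IsInductiveFactorization.glue (h₁ : IsInductiveFactorization A₁ P₁)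
    (h₂ : IsInductiveFactorization A₂ P₂) (hf : Function.Surjective (f₁.prod f₂)) :
    IsInductiveFactorization (A₁.glue A₂ f₁ f₂ hf) (gluePartition P₁ P₂ f₁ f₂) :=
  h₁.glue_of_pullback h₂.isPartitionOf (fun f hf => h₂.pullback f hf) f₁ f₂ hf

theorem IsInductivelyFactored.of_glue {hf : Function.Surjective (f₁.prod f₂)}
    (h : (A₁.glue A₂ f₁ f₂ hf).IsInductivelyFactored) : A₁.IsInductivelyFactored := by
  obtain ⟨P, hP⟩ := h
  rw [← descent_glue A₁ A₂ hf]
  exact ⟨_, hP.descent _ _⟩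

theorem isInductivelyFactored_glue_iff (hf : Function.Surjective (f₁.prod f₂)) :
    (A₁.glue A₂ f₁ f₂ hf).IsInductivelyFactored ↔
      A₁.IsInductivelyFactored ∧ A₂.IsInductivelyFactored := by
  constructor
  · intro h
    exact ⟨h.of_glue, (glue_comm A₁ A₂ hf ▸ h).of_glue⟩
  · rintro ⟨⟨_, h₁⟩, ⟨_, h₂⟩⟩
    exact ⟨_, h₁.glue h₂ hf⟩

theorem isHereditarilyInductivelyFactored_glue_iff (hf : Function.Surjective (f₁.prod f₂)) :
    (A₁.glue A₂ f₁ f₂ hf).IsHereditarilyInductivelyFactored ↔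
      A₁.IsHereditarilyInductivelyFactored ∧ A₂.IsHereditarilyInductivelyFactored :=
  forall_mem_lattice_glue_iff hf fun X₁ X₂ => by
    rw [restriction_inf_glue]
    exact isInductivelyFactored_glue_iff _

end Glue

section Codimension

variable {V V₁ V₂ : Type*} [AddCommGroup V] [Module K V] [AddCommGroup V₁] [Module K V₁]
  [AddCommGroup V₂] [Module K V₂]

theorem finrank_quotient_of_isCoatom {H : Submodule K V} (hH : IsCoatom H) :
    Module.finrank K (V ⧸ H) = 1 :=
  isSimpleModule_iff_finrank_eq_one.1 (isSimpleModule_iff_isCoatom.2 hH)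

theorem cofg_of_isCoatom {H : Submodule K V} (hH : IsCoatom H) : H.CoFG :=
  Module.finite_of_finrank_eq_succ (finrank_quotient_of_isCoatom hH)

theorem cofg_biInf {ι : Type*} {S : Set ι} (hS : S.Finite) {c : ι → Submodule K V}
    (hc : ∀ i ∈ S, IsCoatom (c i)) : (⨅ i ∈ S, c i).CoFG := by
  rw [← sInf_image]
  exact Submodule.CoFG.sInf_of_finite (hS.image c)
    (Set.forall_mem_image.2 fun i hi => cofg_of_isCoatom (hc i hi))

theorem finrank_quotient_comap {f : V →ₗ[K] V₁} (hf : Function.Surjective f)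
    (X : Submodule K V₁) : Module.finrank K (V ⧸ X.comap f) = Module.finrank K (V₁ ⧸ X) := by
  have comap_eq_ker : X.comap f = LinearMap.ker (X.mkQ ∘ₗ f) := by
    rw [LinearMap.ker_comp, Submodule.ker_mkQ]
  rw [comap_eq_ker]
  have surj : Function.Surjective (X.mkQ ∘ₗ f) := X.mkQ_surjective.comp hf
  exact (LinearMap.quotKerEquivOfSurjective _ surj).finrank_eq

theorem finrank_quotient_inf_comap {f₁ : V →ₗ[K] V₁} {f₂ : V →ₗ[K] V₂}
    (hf : Function.Surjective (f₁.prod f₂)) {X₁ : Submodule K V₁} {X₂ : Submodule K V₂}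
    (h₁ : X₁.CoFG) (h₂ : X₂.CoFG) :
    Module.finrank K (V ⧸ X₁.comap f₁ ⊓ X₂.comap f₂) =
      Module.finrank K (V₁ ⧸ X₁) + Module.finrank K (V₂ ⧸ X₂) := by
  have inf_eq_ker : X₁.comap f₁ ⊓ X₂.comap f₂ =
      LinearMap.ker ((X₁.mkQ.prodMap X₂.mkQ) ∘ₗ f₁.prod f₂) := by
    ext v
    simp
  have surj : Function.Surjective ((X₁.mkQ.prodMap X₂.mkQ) ∘ₗ f₁.prod f₂) :=
    (Prod.map_surjective.2 ⟨X₁.mkQ_surjective, X₂.mkQ_surjective⟩).comp hf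
  rw [inf_eq_ker, (LinearMap.quotKerEquivOfSurjective _ surj).finrank_eq, Module.finrank_prod]

theorem finrank_quotient_inf_le (X Y : Submodule K V) :
    Module.finrank K (V ⧸ X ⊓ Y) ≤ Module.finrank K (V ⧸ X) + Module.finrank K (V ⧸ Y) := by
  by_cases h : (X ⊓ Y).CoFG
  · have hX : X.CoFG := h.of_le inf_le_left
    have hY : Y.CoFG := h.of_le inf_le_right
    have ker_eq : LinearMap.ker (X.mkQ.prod Y.mkQ) = X ⊓ Y := by
      rw [LinearMap.ker_prod, Submodule.ker_mkQ, Submodule.ker_mkQ]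
    rw [← Module.finrank_prod, ← ker_eq, (X.mkQ.prod Y.mkQ).quotKerEquivRange.finrank_eq]
    exact Submodule.finrank_le _
  · rw [Module.finrank_of_not_finite h]
    exact Nat.zero_le _

theorem finrank_quotient_biInf_le {ι : Type*} {S : Set ι} (hS : S.Finite)
    (c : ι → Submodule K V) (hc : ∀ i ∈ S, IsCoatom (c i)) :
    Module.finrank K (V ⧸ ⨅ i ∈ S, c i) ≤ S.ncard := by
  induction S, hS using Set.Finite.induction_on with
  | empty =>
    rw [iInf_emptyset, Set.ncard_empty]
    exact Module.finrank_zero_of_subsingleton.le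
  | @insert a S ha hS ih =>
    rw [iInf_insert, Set.ncard_insert_of_notMem ha hS]
    have h_inf := finrank_quotient_inf_le (c a) (⨅ i ∈ S, c i)
    have h_a := finrank_quotient_of_isCoatom (hc a (Set.mem_insert _ _))
    have h_S := ih fun i hi => hc i (Set.mem_insert_of_mem _ hi)
    omega

end Codimension

section Factored

variable {V W V₁ V₂ : Type*} [AddCommGroup V] [Module K V] [AddCommGroup W] [Module K W]
  [AddCommGroup V₁] [Module K V₁] [AddCommGroup V₂] [Module K V₂]

theorem Independent.subset {A : HyperplaneArrangement K V} {P S : Set (Set (Submodule K V))}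
    (h : Independent P) (hP : IsPartitionOf P A.hyperplanes) (hS : S ⊆ P) : Independent S := by
  classical
  intro c hc
  choose! c₀ hc₀ using fun B (hB : B ∈ P) => hP.nonempty hB
  set c' := S.piecewise c c₀
  have hc' : ∀ B ∈ P, c' B ∈ B := fun B hB => by
    by_cases hBS : B ∈ S
    · simpa only [c', Set.piecewise_eq_of_mem _ _ _ hBS] using hc B hBS
    · simpa only [c', Set.piecewise_eq_of_notMem _ _ _ hBS] using hc₀ B hB
  have hcoatom : ∀ B ∈ P, IsCoatom (c' B) := fun B hB => A.isCoatom _ (hP.subset hB (hc' B hB))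
  have hfin := hP.finite A.finite
  have hc_eq : ⨅ B ∈ S, c B = ⨅ B ∈ S, c' B :=
    biInf_congr fun B hB => (Set.piecewise_eq_of_mem _ _ _ hB).symm
  have codim_P := h c' hc'
  rw [← Set.union_sdiff_cancel hS, iInf_union, Set.union_sdiff_cancel hS] at codim_P
  have codim_S := finrank_quotient_biInf_le (hfin.subset hS) c' fun B hB => hcoatom B (hS hB)
  have codim_sdiff := finrank_quotient_biInf_le (hfin.subset Set.sdiff_subset) c'
    fun B (hB : B ∈ P \ S) => hcoatom B hB.1
  have codim_inf := finrank_quotient_inf_le (⨅ B ∈ S, c' B) (⨅ B ∈ P \ S, c' B)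
  have card_P := Set.ncard_sdiff_add_ncard_of_subset hS hfin
  rw [hc_eq]
  omega

theorem Independent.preimagePartition {A : HyperplaneArrangement K V}
    {P : Set (Set (Submodule K V))} (h : Independent P) (hP : IsPartitionOf P A.hyperplanes)
    {f : V →ₗ[K] W} (hf : Function.Surjective f) :
    Independent (preimagePartition (Submodule.comap f) P) := by
  intro c hc
  rw [preimagePartition_eq_image] at hc ⊢
  have comap_biInf : (⨅ C ∈ Set.preimage (Submodule.comap f) ''
      {B ∈ P | (Submodule.comap f ⁻¹' B).Nonempty}, c C).comap f =
      ⨅ B ∈ {B ∈ P | (Submodule.comap f ⁻¹' B).Nonempty},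
        (c (Submodule.comap f ⁻¹' B)).comap f := by
    simp only [iInf_image, Submodule.comap_iInf]
  rw [(hP.injOn_preimage _).ncard_image, ← finrank_quotient_comap hf, comap_biInf]
  exact h.subset hP (Set.sep_subset _ _) _ fun B hB => hc _ ⟨B, hB, rfl⟩

theorem comap_mem_lattice {A : HyperplaneArrangement K V} {f : V →ₗ[K] W}
    {hf : Function.Surjective f} {X : Submodule K W} (hX : X ∈ (A.descent f hf).lattice) :
    X.comap f ∈ A.lattice := by
  obtain ⟨T, hT, rfl⟩ := hX
  refine ⟨Submodule.comap f '' T, Set.image_subset_iff.2 hT, ?_⟩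
  rw [sInf_image, sInf_eq_iInf]
  simp only [Submodule.comap_iInf]

theorem IsFactored.descent {A : HyperplaneArrangement K V} (h : A.IsFactored) (f : V →ₗ[K] W)
    (hf : Function.Surjective f) : (A.descent f hf).IsFactored := by
  obtain ⟨P, hP, hI, hsingleton⟩ := h
  refine ⟨_, hP.preimage _, hI.preimagePartition hP hf, fun X hX hne => ?_⟩
  have comap_ne_top : X.comap f ≠ ⊤ := fun e =>
    hne (Submodule.comap_injective_of_surjective hf (e.trans (Submodule.comap_top f).symm))
  obtain ⟨_, hC, H, rfl⟩ := hsingleton _ (comap_mem_lattice hX) comap_ne_top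
  have hHX : X.comap f ≤ H := by
    obtain ⟨-, B, -, e⟩ := hC
    exact (e ▸ Set.mem_singleton H : H ∈ B ∩ _).2.2
  have comap_map : (H.map f).comap f = H :=
    Submodule.comap_map_eq_self ((LinearMap.ker_le_comap f).trans hHX)
  rw [localization_descent, ← preimagePartition_inducedPartition]
  refine ⟨{H.map f}, ⟨Set.singleton_nonempty _, _, hC, ?_⟩, _, rfl⟩
  ext L
  rw [Set.mem_singleton_iff, Set.mem_preimage, Set.mem_singleton_iff, ← comap_map,
    (Submodule.comap_injective_of_surjective hf).eq_iff, comap_map]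

variable {A₁ : HyperplaneArrangement K V₁} {A₂ : HyperplaneArrangement K V₂}
  {P₁ : Set (Set (Submodule K V₁))} {P₂ : Set (Set (Submodule K V₂))}
  {f₁ : V →ₗ[K] V₁} {f₂ : V →ₗ[K] V₂}

theorem cofg_biInf_of_isPartitionOf {A : HyperplaneArrangement K V} {P : Set (Set (Submodule K V))}
    (hP : IsPartitionOf P A.hyperplanes) {c : Set (Submodule K V) → Submodule K V}
    (hc : ∀ B ∈ P, c B ∈ B) : (⨅ B ∈ P, c B).CoFG :=
  cofg_biInf (hP.finite A.finite)
    fun B hB => A.isCoatom _ (hP.subset hB (hc B hB))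

theorem Independent.glue (hI₁ : Independent P₁) (hI₂ : Independent P₂)
    (h₁ : IsPartitionOf P₁ A₁.hyperplanes) (h₂ : IsPartitionOf P₂ A₂.hyperplanes)
    (hf : Function.Surjective (f₁.prod f₂)) : Independent (gluePartition P₁ P₂ f₁ f₂) := by
  intro c hc
  let c₁ (B : Set (Submodule K V₁)) := (c (Submodule.comap f₁ '' B)).map f₁
  let c₂ (B : Set (Submodule K V₂)) := (c (Submodule.comap f₂ '' B)).map f₂
  have hc₁ : ∀ B ∈ P₁, c₁ B ∈ B ∧ c (Submodule.comap f₁ '' B) = (c₁ B).comap f₁ := by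
    intro B hB
    obtain ⟨H, hH, e⟩ := hc _ (Or.inl ⟨B, hB, rfl⟩)
    simp only [c₁, ← e, Submodule.map_comap_eq_of_surjective (surjective_fst_of_prod hf)]
    exact ⟨hH, trivial⟩
  have hc₂ : ∀ B ∈ P₂, c₂ B ∈ B ∧ c (Submodule.comap f₂ '' B) = (c₂ B).comap f₂ := by
    intro B hB
    obtain ⟨H, hH, e⟩ := hc _ (Or.inr ⟨B, hB, rfl⟩)
    simp only [c₂, ← e, Submodule.map_comap_eq_of_surjective (surjective_snd_of_prod hf)]
    exact ⟨hH, trivial⟩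
  have biInf_eq : (⨅ B ∈ gluePartition P₁ P₂ f₁ f₂, c B) =
      (⨅ B ∈ P₁, c₁ B).comap f₁ ⊓ (⨅ B ∈ P₂, c₂ B).comap f₂ := by
    simp only [gluePartition, iInf_union, iInf_image, Submodule.comap_iInf]
    exact congrArg₂ _ (biInf_congr fun B hB => (hc₁ B hB).2)
      (biInf_congr fun B hB => (hc₂ B hB).2)
  rw [biInf_eq, finrank_quotient_inf_comap hf
      (cofg_biInf_of_isPartitionOf h₁ fun B hB => (hc₁ B hB).1)
      (cofg_biInf_of_isPartitionOf h₂ fun B hB => (hc₂ B hB).1),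
    hI₁ c₁ fun B hB => (hc₁ B hB).1, hI₂ c₂ fun B hB => (hc₂ B hB).1,
    ncard_gluePartition hf h₁ h₂]

theorem preimage_comap_localization_glue (A₁ : HyperplaneArrangement K V₁)
    (A₂ : HyperplaneArrangement K V₂) (hf : Function.Surjective (f₁.prod f₂))
    (X₁ : Submodule K V₁) (X₂ : Submodule K V₂) :
    Submodule.comap f₁ ⁻¹' (A₁.glue A₂ f₁ f₂ hf).localization (X₁.comap f₁ ⊓ X₂.comap f₂) =
      A₁.localization X₁ := by
  ext H
  exact and_congr (Set.ext_iff.1 (congrArg hyperplanes (descent_glue A₁ A₂ hf)) H)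
    (inf_comap_le_comap_fst_iff hf)

theorem exists_singleton_glue (hf : Function.Surjective (f₁.prod f₂)) {X₁ : Submodule K V₁}
    (h : ∃ C ∈ inducedPartition P₁ (A₁.localization X₁), ∃ H, C = {H}) (X₂ : Submodule K V₂)
    (P₂ : Set (Set (Submodule K V₂))) :
    ∃ C ∈ inducedPartition (gluePartition P₁ P₂ f₁ f₂)
      ((A₁.glue A₂ f₁ f₂ hf).localization (X₁.comap f₁ ⊓ X₂.comap f₂)), ∃ H, C = {H} := by
  obtain ⟨_, hC, H, rfl⟩ := h
  rw [inducedPartition_gluePartition, preimage_comap_localization_glue]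
  exact ⟨_, Or.inl ⟨_, hC, rfl⟩, H.comap f₁, Set.image_singleton⟩

theorem IsFactored.glue (h₁ : A₁.IsFactored) (h₂ : A₂.IsFactored)
    (hf : Function.Surjective (f₁.prod f₂)) : (A₁.glue A₂ f₁ f₂ hf).IsFactored := by
  obtain ⟨P₁, hP₁, hI₁, hsingleton₁⟩ := h₁
  obtain ⟨P₂, hP₂, hI₂, hsingleton₂⟩ := h₂
  refine ⟨_, isPartitionOf_glue hf hP₁ hP₂, hI₁.glue hI₂ hP₁ hP₂ hf, fun X hX hne => ?_⟩
  obtain ⟨X₁, hX₁, X₂, hX₂, rfl⟩ := (mem_lattice_glue hf).1 hX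
  by_cases htop : X₁ = ⊤
  · have hne₂ : X₂ ≠ ⊤ := by
      rintro rfl
      rw [htop, Submodule.comap_top, Submodule.comap_top, inf_top_eq] at hne
      exact hne rfl
    rw [glue_comm, gluePartition_comm, inf_comm]
    exact exists_singleton_glue _ (hsingleton₂ X₂ hX₂ hne₂) X₁ P₁
  · exact exists_singleton_glue hf (hsingleton₁ X₁ hX₁ htop) X₂ P₂

theorem IsFactored.of_glue {hf : Function.Surjective (f₁.prod f₂)}
    (h : (A₁.glue A₂ f₁ f₂ hf).IsFactored) : A₁.IsFactored := by
  rw [← descent_glue A₁ A₂ hf]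
  exact h.descent _ _

theorem isFactored_glue_iff (hf : Function.Surjective (f₁.prod f₂)) :
    (A₁.glue A₂ f₁ f₂ hf).IsFactored ↔ A₁.IsFactored ∧ A₂.IsFactored :=
  ⟨fun h => ⟨h.of_glue, (glue_comm A₁ A₂ hf ▸ h).of_glue⟩, fun h => h.1.glue h.2 hf⟩

theorem isHereditarilyFactored_glue_iff (hf : Function.Surjective (f₁.prod f₂)) :
    (A₁.glue A₂ f₁ f₂ hf).IsHereditarilyFactored ↔
      A₁.IsHereditarilyFactored ∧ A₂.IsHereditarilyFactored :=
  forall_mem_lattice_glue_iff hf fun X₁ X₂ => by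
    rw [restriction_inf_glue]
    exact isFactored_glue_iff _

end Factored

end HyperplaneArrangement

section SymmetricAlgebra

open Polynomial SymmetricAlgebra

section Component

variable (R M : Type*) [CommSemiring R] [AddCommMonoid M] [Module R M]

/-- The homomorphism `S(M) → S(M)[X]` with `m ↦ m X`. It multiplies an element of degree `d` by
`X ^ d`, so its coefficients are the projections to the homogeneous components of `S(M)`. -/
noncomputable def symGradingHom : SymmetricAlgebra R M →ₐ[R] (SymmetricAlgebra R M)[X] :=
  lift (LinearMap.mulRight R X ∘ₗ (CAlgHom (R := R)).toLinearMap ∘ₗ ι R M)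

/-- The projection of `S(M)` to its homogeneous component of degree `d`, which is written as
`LinearMap.range (ι R M) ^ d`. -/
noncomputable def symComponent (d : ℕ) : SymmetricAlgebra R M →ₗ[R] SymmetricAlgebra R M :=
  (lcoeff (SymmetricAlgebra R M) d).restrictScalars R ∘ₗ (symGradingHom R M).toLinearMap

variable {R M}

theorem symComponent_apply (d : ℕ) (f : SymmetricAlgebra R M) :
    symComponent R M d f = (symGradingHom R M f).coeff d :=
  rfl

theorem symGradingHom_ι (m : M) : symGradingHom R M (ι R M m) = C (ι R M m) * X := by
  simp [symGradingHom]

theorem symGradingHom_of_mem {d : ℕ} {f : SymmetricAlgebra R M}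
    (hf : f ∈ LinearMap.range (ι R M) ^ d) : symGradingHom R M f = C f * X ^ d := by
  induction hf using Submodule.pow_induction_on_left' with
  | algebraMap r => simp [AlgHom.commutes, Polynomial.algebraMap_apply]
  | add x y i _ _ hx hy => rw [map_add, hx, hy, C_add, add_mul]
  | mem_mul m hm i x _ hx =>
    obtain ⟨m, rfl⟩ := hm
    rw [map_mul, hx, symGradingHom_ι, C_mul, pow_succ]
    ring

theorem symComponent_mul_of_mem {e : ℕ} {g : SymmetricAlgebra R M}
    (hg : g ∈ LinearMap.range (ι R M) ^ e) (h : SymmetricAlgebra R M) (d : ℕ) :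
    symComponent R M d (g * h) = if e ≤ d then g * symComponent R M (d - e) h else 0 := by
  rw [symComponent_apply, map_mul, symGradingHom_of_mem hg, mul_assoc, coeff_C_mul,
    coeff_X_pow_mul', mul_ite, mul_zero, symComponent_apply]

theorem symComponent_of_mem {d : ℕ} {f : SymmetricAlgebra R M}
    (hf : f ∈ LinearMap.range (ι R M) ^ d) : symComponent R M d f = f := by
  rw [symComponent_apply, symGradingHom_of_mem hf, coeff_C_mul, coeff_X_pow_self, mul_one]

theorem symComponent_mem (d : ℕ) (f : SymmetricAlgebra R M) :
    symComponent R M d f ∈ LinearMap.range (ι R M) ^ d := by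
  induction f using SymmetricAlgebra.induction generalizing d with
  | algebraMap r =>
    rw [symComponent_apply, AlgHom.commutes, Polynomial.algebraMap_apply, coeff_C]
    split_ifs with h
    · rw [h, pow_zero]
      exact Submodule.algebraMap_mem r
    · exact zero_mem _
  | ι m =>
    rw [symComponent_apply, symGradingHom_ι, coeff_C_mul, coeff_X]
    split_ifs with h
    · rw [← h, pow_one, mul_one]
      exact LinearMap.mem_range_self _ _
    · rw [mul_zero]
      exact zero_mem _
  | mul a b ha hb =>
    rw [symComponent_apply, map_mul, coeff_mul]
    refine sum_mem fun p hp => ?_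
    rw [← Finset.HasAntidiagonal.mem_antidiagonal.1 hp, pow_add]
    exact Submodule.mul_mem_mul (ha _) (hb _)
  | add a b ha hb =>
    rw [map_add]
    exact add_mem (ha d) (hb d)

theorem prod_ι_mem_range_pow_card {κ : Type*} (s : Finset κ) (m : κ → M) :
    ∏ i ∈ s, ι R M (m i) ∈ LinearMap.range (ι R M) ^ s.card := by
  induction s using Finset.cons_induction with
  | empty => exact Submodule.one_le.1 (pow_zero (LinearMap.range (ι R M))).ge
  | cons a s ha ih =>
    rw [Finset.prod_cons, Finset.card_cons, pow_succ']
    exact Submodule.mul_mem_mul (LinearMap.mem_range_self _ _) ih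

end Component

section Map

variable {R M N : Type*} [CommSemiring R] [AddCommMonoid M] [Module R M] [AddCommMonoid N]
  [Module R N]

/-- The homomorphism `S(M) → S(N)` induced by a linear map `M → N`. -/
noncomputable def symMap (u : M →ₗ[R] N) : SymmetricAlgebra R M →ₐ[R] SymmetricAlgebra R N :=
  lift (ι R N ∘ₗ u)

@[simp]
theorem symMap_ι (u : M →ₗ[R] N) (m : M) : symMap u (ι R M m) = ι R N (u m) :=
  lift_ι_apply _ _

theorem symMap_mem_range_pow (u : M →ₗ[R] N) {d : ℕ} {f : SymmetricAlgebra R M}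
    (hf : f ∈ LinearMap.range (ι R M) ^ d) : symMap u f ∈ LinearMap.range (ι R N) ^ d := by
  have hmap : (LinearMap.range (ι R M)).map (symMap u).toLinearMap ≤ LinearMap.range (ι R N) := by
    rintro _ ⟨_, ⟨m, rfl⟩, rfl⟩
    exact ⟨u m, (symMap_ι u m).symm⟩
  have hpow := pow_le_pow_left' hmap d
  rw [← Submodule.map_pow] at hpow
  exact hpow (Submodule.mem_map_of_mem hf)

theorem symMap_symMap_of_comp_eq_id {u : M →ₗ[R] N} {s : N →ₗ[R] M} (hs : u ∘ₗ s = .id)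
    (f : SymmetricAlgebra R N) : symMap u (symMap s f) = f := by
  have hcomp : (symMap u).comp (symMap s) = AlgHom.id R _ := by
    ext m
    simpa using congrArg (ι R N) (LinearMap.congr_fun hs m)
  exact DFunLike.congr_fun hcomp f

end Map

section Kernel

variable {R M N : Type*} [CommRing R] [AddCommGroup M] [Module R M] [AddCommGroup N] [Module R N]

theorem symMap_eq_zero_iff_dvd {u : M →ₗ[R] N} {s : N →ₗ[R] M} (hs : u ∘ₗ s = .id) {m₀ : M}
    (hm₀ : LinearMap.ker u = R ∙ m₀) {f : SymmetricAlgebra R M} :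
    symMap u f = 0 ↔ ι R M m₀ ∣ f := by
  constructor
  · intro hf
    let I := Ideal.span {ι R M m₀}
    have hsection : Ideal.Quotient.mkₐ R I =
        (Ideal.Quotient.mkₐ R I).comp ((symMap s).comp (symMap u)) := by
      refine algHom_ext (LinearMap.ext fun m => ?_)
      change Ideal.Quotient.mk I (ι R M m) = Ideal.Quotient.mk I (symMap s (symMap u (ι R M m)))
      rw [symMap_ι, symMap_ι, Ideal.Quotient.eq, ← map_sub, Ideal.mem_span_singleton]
      have hker : m - s (u m) ∈ LinearMap.ker u := by
        rw [LinearMap.mem_ker, map_sub, sub_eq_zero]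
        exact (LinearMap.congr_fun hs (u m)).symm
      rw [hm₀, Submodule.mem_span_singleton] at hker
      obtain ⟨c, hc⟩ := hker
      rw [← hc, map_smul, Algebra.smul_def]
      exact Dvd.intro_left _ rfl
    have hfI := DFunLike.congr_fun hsection f
    rwa [AlgHom.comp_apply, AlgHom.comp_apply, hf, map_zero, map_zero, Ideal.Quotient.mkₐ_eq_mk,
      Ideal.Quotient.eq_zero_iff_mem, Ideal.mem_span_singleton] at hfI
  · rintro ⟨g, rfl⟩
    have hu : u m₀ = 0 := LinearMap.mem_ker.1 (hm₀ ▸ Submodule.mem_span_singleton_self m₀)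
    rw [map_mul, symMap_ι, hu, map_zero, zero_mul]

end Kernel

section Derivation

variable {R M : Type*} [CommRing R] [AddCommGroup M] [Module R M]

/-- The derivation of `S(M)` with prescribed values on `M`. It is the second component of the
algebra homomorphism from `S(M)` to its trivial square zero extension with `m ↦ (m, φ m)`. -/
noncomputable def symDerivation (φ : M →ₗ[R] SymmetricAlgebra R M) :
    Derivation R (SymmetricAlgebra R M) (SymmetricAlgebra R M) :=
  let F : SymmetricAlgebra R M →ₐ[R] TrivSqZeroExt (SymmetricAlgebra R M) (SymmetricAlgebra R M) :=
    lift ((TrivSqZeroExt.inlAlgHom R (SymmetricAlgebra R M) (SymmetricAlgebra R M)).toLinearMap ∘ₗ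
      ι R M + (TrivSqZeroExt.inrHom (SymmetricAlgebra R M)
        (SymmetricAlgebra R M)).restrictScalars R ∘ₗ φ)
  have fst_F : ∀ f, (F f).fst = f := fun f => by
    have hcomp : (TrivSqZeroExt.fstHom R (SymmetricAlgebra R M) (SymmetricAlgebra R M)).comp F =
        AlgHom.id R _ := by
      ext m
      simp [F]
    exact DFunLike.congr_fun hcomp f
  Derivation.mk' ((TrivSqZeroExt.sndHom (SymmetricAlgebra R M)
    (SymmetricAlgebra R M)).restrictScalars R ∘ₗ F.toLinearMap) fun a b => by
      simp [fst_F, mul_comm]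

@[simp]
theorem symDerivation_ι (φ : M →ₗ[R] SymmetricAlgebra R M) (m : M) :
    symDerivation φ (ι R M m) = φ m := by
  simp [symDerivation]

theorem derivation_symmetricAlgebra_ext
    {θ η : Derivation R (SymmetricAlgebra R M) (SymmetricAlgebra R M)}
    (h : ∀ m, θ (ι R M m) = η (ι R M m)) : θ = η := by
  ext f
  induction f using SymmetricAlgebra.induction with
  | algebraMap r => simp
  | ι m => exact h m
  | mul a b ha hb => simp [ha, hb]
  | add a b ha hb => simp [ha, hb]

variable (R M) in
/-- A derivation of `S(M)` is determined by its restriction to `M`, which is arbitrary. -/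
noncomputable def symDerivationEquiv :
    Derivation R (SymmetricAlgebra R M) (SymmetricAlgebra R M) ≃ₗ[SymmetricAlgebra R M]
      (M →ₗ[R] SymmetricAlgebra R M) where
  toFun θ := θ.toLinearMap ∘ₗ ι R M
  map_add' _ _ := rfl
  map_smul' _ _ := rfl
  invFun := symDerivation
  left_inv _ := derivation_symmetricAlgebra_ext fun _ => symDerivation_ι _ _
  right_inv _ := LinearMap.ext fun _ => symDerivation_ι _ _

theorem exists_eq_smul_of_dvd_apply_ι [Module.Free R M]
    {θ : Derivation R (SymmetricAlgebra R M) (SymmetricAlgebra R M)} {a : SymmetricAlgebra R M}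
    (h : ∀ m, a ∣ θ (ι R M m)) :
    ∃ η : Derivation R (SymmetricAlgebra R M) (SymmetricAlgebra R M), θ = a • η := by
  let b := Module.Free.chooseBasis R M
  choose q hq using fun i => h (b i)
  refine ⟨(symDerivationEquiv R M).symm (b.constr R q), ?_⟩
  rw [← map_smul, LinearEquiv.eq_symm_apply]
  refine b.ext fun i => ?_
  rw [LinearMap.smul_apply, Module.Basis.constr_basis, smul_eq_mul, ← hq i]
  rfl

end Derivation

section Prime

theorem ι_eq_zero_iff {R M : Type*} [CommRing R] [AddCommGroup M] [Module R M]
    [Module.Projective R M] {m : M} : ι R M m = 0 ↔ m = 0 := by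
  refine ⟨fun h => (Module.forall_dual_apply_eq_zero_iff R m).1 fun φ => ?_,
    fun h => by rw [h, map_zero]⟩
  rw [← lift_ι_apply φ m, h, map_zero]

instance uniqueFactorizationMonoid_symmetricAlgebra {R M : Type*} [CommRing R] [IsDomain R]
    [UniqueFactorizationMonoid R] [AddCommGroup M] [Module R M] [Module.Free R M] :
    UniqueFactorizationMonoid (SymmetricAlgebra R M) :=
  (equivMvPolynomial (Module.Free.chooseBasis R M)).symm.toMulEquiv.uniqueFactorizationMonoid
    inferInstance

variable {K M : Type*} [Field K] [AddCommGroup M] [Module K M]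

theorem symMap_mkQ_eq_zero_iff_dvd {m : M} {f : SymmetricAlgebra K M} :
    symMap (K ∙ m).mkQ f = 0 ↔ ι K M m ∣ f := by
  obtain ⟨s, hs⟩ := (K ∙ m).mkQ.exists_rightInverse_of_surjective (Submodule.range_mkQ _)
  exact symMap_eq_zero_iff_dvd hs (Submodule.ker_mkQ _)

theorem ι_dvd_ι_iff_mem_span_singleton {m n : M} : ι K M m ∣ ι K M n ↔ n ∈ K ∙ m := by
  rw [← symMap_mkQ_eq_zero_iff_dvd, symMap_ι, ι_eq_zero_iff, Submodule.mkQ_apply,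
    Submodule.Quotient.mk_eq_zero]

theorem prime_symmetricAlgebra_ι {m : M} (hm : m ≠ 0) : Prime (ι K M m) := by
  refine ⟨fun h => hm (ι_eq_zero_iff.1 h), fun hunit => ?_, fun a b hab => ?_⟩
  · have hzero := hunit.map (algebraMapInv (R := K) (M := M))
    rw [algebraMapInv_ι] at hzero
    exact not_isUnit_zero hzero
  · rw [← symMap_mkQ_eq_zero_iff_dvd, map_mul] at hab
    rw [← symMap_mkQ_eq_zero_iff_dvd, ← symMap_mkQ_eq_zero_iff_dvd]
    exact mul_eq_zero.1 hab

end Prime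

end SymmetricAlgebra

namespace HyperplaneArrangement

open Module

variable {K : Type*} [Field K] {V : Type*} [AddCommGroup V] [Module K V]

section LinearForms

/-- A linear form, as an element of degree one of the coordinate ring. -/
abbrev linForm (α : Dual K V) : CoordRing K V :=
  SymmetricAlgebra.ι K (Dual K V) α

theorem mem_span_singleton_iff_ker_le {α β : Dual K V} :
    β ∈ K ∙ α ↔ LinearMap.ker α ≤ LinearMap.ker β := by
  refine ⟨fun hβ => ?_, fun hle => ?_⟩
  · obtain ⟨c, rfl⟩ := Submodule.mem_span_singleton.1 hβ
    exact LinearMap.ker_le_ker_smul _ _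
  · rw [← Set.range_const (ι := Unit)]
    exact mem_span_of_iInf_ker_le_ker (L := fun _ => α) (iInf_const.trans_le hle)

theorem exists_ker_eq_of_isCoatom {H : Submodule K V} (hH : IsCoatom H) :
    ∃ α : Dual K V, LinearMap.ker α = H := by
  obtain ⟨α, hα, hle⟩ := H.exists_le_ker_of_lt_top hH.lt_top
  exact ⟨α, (hH.le_iff_eq fun htop => hα (LinearMap.ker_eq_top.1 htop)).1 hle⟩

theorem ne_zero_of_isCoatom_ker {α : Dual K V} (hα : IsCoatom (LinearMap.ker α)) : α ≠ 0 := by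
  rintro rfl
  exact hα.1 LinearMap.ker_zero

theorem prime_linForm {α : Dual K V} (hα : IsCoatom (LinearMap.ker α)) : Prime (linForm α) :=
  prime_symmetricAlgebra_ι (ne_zero_of_isCoatom_ker hα)

theorem not_linForm_dvd_linForm {α β : Dual K V} (hα : IsCoatom (LinearMap.ker α))
    (hβ : IsCoatom (LinearMap.ker β)) (hne : LinearMap.ker α ≠ LinearMap.ker β) :
    ¬ linForm α ∣ linForm β := fun hdvd =>
  hne ((hα.le_iff_eq hβ.1).1
    (mem_span_singleton_iff_ker_le.1 (ι_dvd_ι_iff_mem_span_singleton.1 hdvd))).symm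

theorem linForm_dvd_apply_of_mem_span {θ : Derivation K (CoordRing K V) (CoordRing K V)}
    {α β : Dual K V} (h : linForm α ∣ θ (linForm α)) (hβ : β ∈ K ∙ α) :
    linForm β ∣ θ (linForm β) := by
  obtain ⟨c, rfl⟩ := Submodule.mem_span_singleton.1 hβ
  rw [linForm, map_smul, Derivation.map_smul, Algebra.smul_def, Algebra.smul_def]
  exact mul_dvd_mul_left _ h

theorem mem_derivationModule_iff_deletion {A : HyperplaneArrangement K V} {α : Dual K V}
    (hα : LinearMap.ker α ∈ A.hyperplanes)
    {θ : Derivation K (CoordRing K V) (CoordRing K V)} :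
    θ ∈ A.derivationModule ↔ θ ∈ (A.deletion (LinearMap.ker α)).derivationModule ∧
      linForm α ∣ θ (linForm α) := by
  refine ⟨fun h => ⟨fun H hH => h H hH.1, h _ hα α rfl⟩, fun ⟨h', hdvd⟩ H hH γ hγ => ?_⟩
  by_cases hne : H = LinearMap.ker α
  · exact linForm_dvd_apply_of_mem_span hdvd (mem_span_singleton_iff_ker_le.2 (hγ.trans hne).ge)
  · exact h' H ⟨hH, hne⟩ γ hγ

end LinearForms

section RestrictFun

/-- The restriction of polynomial functions from `V` to the subspace `X`. -/
noncomputable def restrictFun (X : Submodule K V) : CoordRing K V →ₐ[K] CoordRing K X :=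
  symMap X.dualRestrict

theorem restrictFun_linForm (X : Submodule K V) (α : Dual K V) :
    restrictFun X (linForm α) = linForm (X.dualRestrict α) :=
  symMap_ι _ _

theorem ker_dualRestrict_ker (α : Dual K V) :
    LinearMap.ker (LinearMap.ker α).dualRestrict = K ∙ α := by
  ext β
  rw [Submodule.dualRestrict_ker_eq_dualAnnihilator, Submodule.mem_dualAnnihilator,
    mem_span_singleton_iff_ker_le]
  rfl

theorem restrictFun_eq_zero_iff {α : Dual K V} {f : CoordRing K V} :
    restrictFun (LinearMap.ker α) f = 0 ↔ linForm α ∣ f :=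
  symMap_eq_zero_iff_dvd (Subspace.dualRestrict_comp_dualLift _) (ker_dualRestrict_ker α)

theorem restrictFun_mem_homogeneousPart (X : Submodule K V) {d : ℕ} {f : CoordRing K V}
    (hf : f ∈ homogeneousPart K V d) : restrictFun X f ∈ homogeneousPart K X d :=
  symMap_mem_range_pow _ hf

/-- A section of `restrictFun`, which depends on the choice of a complement of `X`. -/
noncomputable def extendFun (X : Submodule K V) : CoordRing K X →ₐ[K] CoordRing K V :=
  symMap (Subspace.dualLift X)

theorem restrictFun_extendFun (X : Submodule K V) (f : CoordRing K X) :
    restrictFun X (extendFun X f) = f :=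
  symMap_symMap_of_comp_eq_id (Subspace.dualRestrict_comp_dualLift X) f

theorem extendFun_mem_homogeneousPart {X : Submodule K V} {d : ℕ} {f : CoordRing K X}
    (hf : f ∈ homogeneousPart K X d) : extendFun X f ∈ homogeneousPart K V d :=
  symMap_mem_range_pow _ hf

end RestrictFun

section HomogeneousDerivation

variable {θ η : Derivation K (CoordRing K V) (CoordRing K V)} {d e : ℕ}

theorem IsHomogeneousDerivation.sub (hθ : IsHomogeneousDerivation θ d)
    (hη : IsHomogeneousDerivation η d) : IsHomogeneousDerivation (θ - η) d :=
  fun α => sub_mem (hθ α) (hη α)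

theorem IsHomogeneousDerivation.smul {f : CoordRing K V} (hf : f ∈ homogeneousPart K V e)
    (hθ : IsHomogeneousDerivation θ d) : IsHomogeneousDerivation (f • θ) (e + d) := fun α => by
  rw [homogeneousPart, pow_add]
  exact Submodule.mul_mem_mul hf (hθ α)

theorem derivation_sum_apply {R S κ : Type*} [CommRing R] [CommRing S] [Algebra R S]
    (s : Finset κ) (θ : κ → Derivation R S S) (f : S) : (∑ i ∈ s, θ i) f = ∑ i ∈ s, θ i f := by
  simpa only [Finset.sum_apply, Derivation.coeFnAddMonoidHom_apply]
    using congrFun (map_sum Derivation.coeFnAddMonoidHom θ s) f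

end HomogeneousDerivation

section RestrictDerivation

/-- The derivation induced by `θ` on the coordinate ring of `X`. It does not depend on the choice
made in `Subspace.dualLift` if `θ` preserves the ideal of `X`, which is the case of interest. -/
noncomputable def restrictDerivation (X : Submodule K V)
    (θ : Derivation K (CoordRing K V) (CoordRing K V)) :
    Derivation K (CoordRing K X) (CoordRing K X) :=
  symDerivation ((restrictFun X).toLinearMap ∘ₗ θ.toLinearMap ∘ₗ
    SymmetricAlgebra.ι K (Dual K V) ∘ₗ Subspace.dualLift X)

theorem restrictDerivation_linForm (X : Submodule K V)
    (θ : Derivation K (CoordRing K V) (CoordRing K V)) (β : Dual K X) :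
    restrictDerivation X θ (linForm β) = restrictFun X (θ (linForm (Subspace.dualLift X β))) :=
  symDerivation_ι _ _

theorem IsHomogeneousDerivation.restrictDerivation {d : ℕ} (X : Submodule K V)
    {θ : Derivation K (CoordRing K V) (CoordRing K V)} (hθ : IsHomogeneousDerivation θ d) :
    IsHomogeneousDerivation (restrictDerivation X θ) d := fun β => by
  rw [restrictDerivation_linForm X θ β]
  exact restrictFun_mem_homogeneousPart X (hθ _)

theorem restrictDerivation_dualRestrict {θ : Derivation K (CoordRing K V) (CoordRing K V)}
    {α : Dual K V} (hα : linForm α ∣ θ (linForm α)) (β : Dual K V) :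
    restrictDerivation (LinearMap.ker α) θ (linForm ((LinearMap.ker α).dualRestrict β)) =
      restrictFun (LinearMap.ker α) (θ (linForm β)) := by
  set X := LinearMap.ker α
  have hker : Subspace.dualLift X (X.dualRestrict β) - β ∈ LinearMap.ker X.dualRestrict := by
    rw [LinearMap.mem_ker, map_sub, sub_eq_zero]
    exact LinearMap.congr_fun (Subspace.dualRestrict_comp_dualLift X) _
  rw [ker_dualRestrict_ker, Submodule.mem_span_singleton] at hker
  obtain ⟨c, hc⟩ := hker
  rw [restrictDerivation_linForm, ← sub_eq_zero, ← map_sub, ← map_sub, linForm, linForm, ← map_sub,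
    ← hc, map_smul, Derivation.map_smul, map_smul, restrictFun_eq_zero_iff.2 hα, smul_zero]

theorem restrictDerivation_mem {A : HyperplaneArrangement K V} {α : Dual K V}
    (hα : LinearMap.ker α ∈ A.hyperplanes) {θ : Derivation K (CoordRing K V) (CoordRing K V)}
    (hθ : θ ∈ A.derivationModule) :
    restrictDerivation (LinearMap.ker α) θ ∈
      (A.restriction (LinearMap.ker α)).derivationModule := by
  intro L hL β hβ
  obtain ⟨H, hH, -, rfl⟩ := mem_restriction.1 hL
  obtain ⟨γ, rfl⟩ := exists_ker_eq_of_isCoatom (A.isCoatom H hH)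
  refine linForm_dvd_apply_of_mem_span (α := (LinearMap.ker α).dualRestrict γ) ?_
    (mem_span_singleton_iff_ker_le.2 hβ.ge)
  rw [restrictDerivation_dualRestrict (hθ _ hα α rfl), ← restrictFun_linForm]
  exact map_dvd _ (hθ _ hH γ rfl)

variable {A : HyperplaneArrangement K V} {ι κ : Type*}

theorem linForm_dvd_repr (b : Basis ι (CoordRing K V) A.derivationModule) {α : Dual K V}
    (hα : IsCoatom (LinearMap.ker α)) (hA : LinearMap.ker α ∉ A.hyperplanes)
    {θ : A.derivationModule} (hθ : ∀ β, linForm α ∣ θ.1 (linForm β)) (i : ι) :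
    linForm α ∣ b.repr θ i := by
  obtain ⟨η, hη⟩ := exists_eq_smul_of_dvd_apply_ι hθ
  have η_mem : η ∈ A.derivationModule := by
    intro H hH β hβ
    have hβco : IsCoatom (LinearMap.ker β) := hβ ▸ A.isCoatom H hH
    have hdvd := θ.2 H hH β hβ
    rw [hη, Derivation.smul_apply, smul_eq_mul] at hdvd
    refine ((prime_linForm hβco).dvd_or_dvd hdvd).resolve_left
      (not_linForm_dvd_linForm hβco hα fun heq => hA ?_)
    rw [← heq, hβ]
    exact hH
  have hθη : θ = linForm α • (⟨η, η_mem⟩ : A.derivationModule) := Subtype.ext hη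
  rw [hθη, map_smul]
  exact ⟨_, rfl⟩

theorem linearIndependent_restrictDerivation (b : Basis ι (CoordRing K V) A.derivationModule)
    {α : Dual K V} (hα : IsCoatom (LinearMap.ker α)) (hA : LinearMap.ker α ∉ A.hyperplanes)
    {v : κ → ι} (hv : v.Injective) (hdvd : ∀ k, linForm α ∣ (b (v k)).1 (linForm α)) :
    LinearIndependent (CoordRing K (LinearMap.ker α))
      fun k => restrictDerivation (LinearMap.ker α) (b (v k)).1 := by
  classical
  set X := LinearMap.ker α
  refine linearIndependent_iff'.2 fun s g hg k hk => ?_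
  set θ : A.derivationModule := ∑ j ∈ s, extendFun X (g j) • b (v j) with hθ
  have θ_dvd : ∀ β, linForm α ∣ θ.1 (linForm β) := fun β => by
    rw [← restrictFun_eq_zero_iff, hθ, Submodule.coe_sum, derivation_sum_apply, map_sum]
    have hβ := DFunLike.congr_fun hg (linForm (X.dualRestrict β))
    rw [derivation_sum_apply] at hβ
    refine Eq.trans (Finset.sum_congr rfl fun j _ => ?_) hβ
    rw [Submodule.coe_smul, Derivation.smul_apply, Derivation.smul_apply, smul_eq_mul, smul_eq_mul,
      map_mul, restrictFun_extendFun, restrictDerivation_dualRestrict (hdvd j)]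
  have θ_repr : b.repr θ (v k) = extendFun X (g k) := by
    simp [hθ, Finsupp.finsetSum_apply, Finsupp.single_apply, hv.eq_iff, hk]
  rw [← restrictFun_extendFun X (g k), ← θ_repr, restrictFun_eq_zero_iff]
  exact linForm_dvd_repr b hα hA θ_dvd (v k)

end RestrictDerivation

section UniqueExponents

variable {D : Submodule (CoordRing K V) (Derivation K (CoordRing K V) (CoordRing K V))}
  {ι κ : Type*} (b : Basis ι (CoordRing K V) D) {d : ι → ℕ}
  (hd : ∀ i, IsHomogeneousDerivation (b i).1 (d i))

theorem repr_apply_of_eq_sum_smul {R M : Type*} [Semiring R] [AddCommMonoid M] [Module R M]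
    (b : Basis ι R M) {s : Finset ι} {c : ι → R} {x : M} (hx : x = ∑ j ∈ s, c j • b j) {i : ι}
    (hi : i ∈ s) : b.repr x i = c i := by
  classical
  simp [hx, Finsupp.finsetSum_apply, Finsupp.single_apply, hi]

include hd

theorem repr_eq_zero_of_lt {θ : D} {e : ℕ} (hθ : IsHomogeneousDerivation θ.1 e) {i : ι}
    (hi : e < d i) : b.repr θ i = 0 := by
  by_contra hne
  set s := (b.repr θ).support
  let c : ι → CoordRing K V := fun j =>
    if d j ≤ e then symComponent K (Dual K V) (e - d j) (b.repr θ j) else 0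
  have θ_eq : θ = ∑ j ∈ s, b.repr θ j • b j := (b.linearCombination_repr θ).symm
  have θ_eq_components : θ = ∑ j ∈ s, c j • b j := by
    refine Subtype.ext (derivation_symmetricAlgebra_ext fun β => ?_)
    have hβ := congrArg (symComponent K (Dual K V) e)
      (congrArg (fun η : D => η.1 (linForm β)) θ_eq)
    simp only [Submodule.coe_sum, Submodule.coe_smul, derivation_sum_apply, map_sum] at hβ ⊢
    rw [symComponent_of_mem (hθ β)] at hβ
    refine hβ.trans (Finset.sum_congr rfl fun j _ => ?_)
    rw [Derivation.smul_apply, Derivation.smul_apply, smul_eq_mul, smul_eq_mul, mul_comm,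
      symComponent_mul_of_mem (hd j β), ite_mul, zero_mul, mul_comm]
  exact hne ((repr_apply_of_eq_sum_smul b θ_eq_components (Finsupp.mem_support_iff.2 hne)).trans
    (if_neg (not_le.2 hi)))

theorem card_le_card_filter_of_linearIndependent [Fintype ι] [Fintype κ] {θ : κ → D}
    (hli : LinearIndependent (CoordRing K V) θ) {e : κ → ℕ}
    (he : ∀ j, IsHomogeneousDerivation (θ j).1 (e j)) {m : ℕ} (hm : ∀ j, e j < m) :
    Fintype.card κ ≤ (Finset.univ.filter fun i => d i < m).card := by
  classical
  let s : Finset D := (Finset.univ.filter fun i => d i < m).image b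
  have hs : Set.range θ ⊆ Submodule.span (CoordRing K V) (s : Set D) := by
    rintro _ ⟨j, rfl⟩
    rw [SetLike.mem_coe, Finset.coe_image, b.mem_span_image]
    intro i hi
    rw [Finset.mem_coe, Finset.mem_filter]
    refine ⟨Finset.mem_univ i, not_le.1 fun hle => Finsupp.mem_support_iff.1 hi ?_⟩
    exact repr_eq_zero_of_lt b hd (he j) ((hm j).trans_le hle)
  have hcard := linearIndependent_le_span_aux' θ hli _ hs
  exact (hcard.trans_eq (Fintype.card_coe s)).trans Finset.card_image_le

end UniqueExponents

section UniqueExponents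

theorem countP_lt_add_one (s : Multiset ℕ) (m : ℕ) :
    s.countP (· < m + 1) = s.countP (· < m) + s.count m := by
  induction s using Multiset.induction_on with
  | empty => simp
  | cons a s ih =>
    simp only [Multiset.countP_cons, Multiset.count_cons, ih]
    split_ifs <;> omega

theorem eq_of_countP_lt_eq {s t : Multiset ℕ}
    (h : ∀ m, s.countP (· < m) = t.countP (· < m)) : s = t := by
  ext m
  have hm := h (m + 1)
  rwa [countP_lt_add_one, countP_lt_add_one, h m, Nat.add_left_cancel_iff] at hm

theorem countP_lt_map_univ {ι : Type*} [Fintype ι] (d : ι → ℕ) (m : ℕ) :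
    (Multiset.map d Finset.univ.val).countP (· < m) =
      (Finset.univ.filter fun i => d i < m).card :=
  Multiset.countP_map _ _ _

variable {A : HyperplaneArrangement K V} {e e' : Multiset ℕ}

theorem HasHomogeneousBasis.countP_lt_le (h : A.HasHomogeneousBasis e)
    (h' : A.HasHomogeneousBasis e') (m : ℕ) : e'.countP (· < m) ≤ e.countP (· < m) := by
  obtain ⟨n, b, d, hd, rfl⟩ := h
  obtain ⟨n', b', d', hd', rfl⟩ := h'
  rw [countP_lt_map_univ, countP_lt_map_univ, ← Fintype.card_subtype]
  exact card_le_card_filter_of_linearIndependent b hd (κ := {j // d' j < m})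
    (b'.linearIndependent.comp _ Subtype.val_injective) (fun j => hd' j.1) Subtype.property

theorem HasHomogeneousBasis.isFreeWithExponents (h : A.HasHomogeneousBasis e) :
    A.IsFreeWithExponents e :=
  ⟨h, fun _ h' => eq_of_countP_lt_eq fun m =>
    le_antisymm (h.countP_lt_le h' m) (h'.countP_lt_le h m)⟩

end UniqueExponents

section Addition

theorem exists_basis_of_mem_iff_dvd {R E ι : Type*} [CommRing R] [IsDomain R] [AddCommGroup E]
    [Module R E] {M N : Submodule R E} (b : Basis ι R M) {i : ι} {φ : M →ₗ[R] R}
    (hφ : φ (b i) = 1) {a : R} (ha : a ≠ 0) (hN : ∀ x, x ∈ N ↔ ∃ h : x ∈ M, a ∣ φ ⟨x, h⟩) :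
    ∃ c : Basis ι R N,
      (c i : E) = a • (b i : E) ∧ ∀ j ≠ i, (c j : E) = b j - φ (b j) • (b i : E) := by
  let μ : M →ₗ[R] M := LinearMap.id + (a • b.coord i - φ).smulRight (b i)
  have μ_apply (x : M) : μ x = x + (a * b.coord i x - φ x) • b i := rfl
  have φ_μ (x : M) : φ (μ x) = a * b.coord i x := by
    rw [μ_apply, map_add, map_smul, hφ, smul_eq_mul, mul_one, add_sub_cancel]
  have coord_self : b.coord i (b i) = 1 := by simp
  let ν : M →ₗ[R] N := (M.subtype ∘ₗ μ).codRestrict N fun x =>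
    (hN _).2 ⟨(μ x).2, (φ_μ x).symm ▸ dvd_mul_right _ _⟩
  have ν_injective : Function.Injective ν := (injective_iff_map_eq_zero ν).2 fun x hx => by
    have hμ : μ x = 0 := Subtype.ext (congrArg N.subtype hx :)
    have hcoord : b.coord i x = 0 := by
      simpa only [hμ, map_zero, zero_eq_mul, ha, false_or] using φ_μ x
    have hx_eq : x = φ x • b i := by
      rw [μ_apply, hcoord, mul_zero, zero_sub, neg_smul, add_neg_eq_zero] at hμ
      exact hμ
    rw [hx_eq, map_smul, coord_self, smul_eq_mul, mul_one] at hcoord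
    rw [hx_eq, hcoord, zero_smul]
  have ν_surjective : Function.Surjective ν := by
    rintro ⟨y, hy⟩
    obtain ⟨hyM, t, ht⟩ := (hN y).1 hy
    refine ⟨⟨y, hyM⟩ + (t - b.coord i ⟨y, hyM⟩) • b i, Subtype.ext ?_⟩
    suffices hμ : μ (⟨y, hyM⟩ + (t - b.coord i ⟨y, hyM⟩) • b i) = ⟨y, hyM⟩ from
      congrArg M.subtype hμ
    rw [μ_apply, map_add, map_add, map_smul, map_smul, hφ, coord_self, ht, add_assoc, ← add_smul]
    simp only [smul_eq_mul, mul_one, add_sub_cancel, sub_add_cancel_left, add_neg_cancel, zero_smul,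
      add_zero]
  refine ⟨b.map (LinearEquiv.ofBijective ν ⟨ν_injective, ν_surjective⟩), ?_, fun j hj => ?_⟩
  · change ((b i + (a * b.coord i (b i) - φ (b i)) • b i : M) : E) = _
    rw [coord_self, hφ, mul_one, sub_smul, one_smul, add_sub_cancel, Submodule.coe_smul]
  · change ((b j + (a * b.coord i (b j) - φ (b j)) • b i : M) : E) = _
    rw [b.coord_apply, b.repr_self, Finsupp.single_eq_of_ne hj.symm, mul_zero, zero_sub, neg_smul,
      ← sub_eq_add_neg, Submodule.coe_sub, Submodule.coe_smul]

theorem map_update_univ {ι β : Type*} [Fintype ι] [DecidableEq ι] (d : ι → β) (i : ι) (x : β)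
    {e : Multiset β} (h : Multiset.map d Finset.univ.val = d i ::ₘ e) :
    Multiset.map (Function.update d i x) Finset.univ.val = x ::ₘ e := by
  have hi : i ∈ (Finset.univ : Finset ι).val := Finset.mem_univ i
  have hcongr : ∀ j ∈ (Finset.univ : Finset ι).val.erase i, Function.update d i x j = d j :=
    fun j hj => Function.update_of_ne (Finset.univ.nodup.mem_erase_iff.1 hj).1 _ _
  rw [← Multiset.cons_erase hi, Multiset.map_cons, Multiset.cons_inj_right] at h
  rw [← Multiset.cons_erase hi, Multiset.map_cons, Function.update_self,
    Multiset.map_congr rfl hcongr, h]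

theorem linForm_dvd_sub_mul_constr {ι : Type*}
    {D : Submodule (CoordRing K V) (Derivation K (CoordRing K V) (CoordRing K V))}
    (b : Basis ι (CoordRing K V) D) {α : Dual K V} {f : CoordRing K V} {s : ι → CoordRing K V}
    (h : ∀ j, linForm α ∣ (b j).1 (linForm α) - f * s j) (θ : D) :
    linForm α ∣ θ.1 (linForm α) - f * b.constr (CoordRing K V) s θ := by
  have hθ : θ.1 (linForm α) = ∑ j ∈ (b.repr θ).support, b.repr θ j * (b j).1 (linForm α) := by
    conv_lhs => rw [← b.linearCombination_repr θ, Finsupp.linearCombination_apply, Finsupp.sum]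
    rw [Submodule.coe_sum, derivation_sum_apply]
    rfl
  rw [hθ, b.constr_apply, Finsupp.sum, Finset.mul_sum, ← Finset.sum_sub_distrib]
  refine Finset.dvd_sum fun j _ => ?_
  rw [smul_eq_mul, mul_left_comm, ← mul_sub]
  exact (h j).mul_left _

theorem exists_homogeneous_cofactor {f g : CoordRing K V} {m n : ℕ}
    (hf : f ∈ homogeneousPart K V m) (hg : g ∈ homogeneousPart K V n) (hdvd : f ∣ g) :
    ∃ q, g = f * q ∧ (m ≤ n → q ∈ homogeneousPart K V (n - m)) ∧ (n < m → q = 0) := by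
  obtain ⟨c, rfl⟩ := hdvd
  refine ⟨if m ≤ n then symComponent K (Dual K V) (n - m) c else 0, ?_, fun h => ?_, fun h => ?_⟩
  · rw [mul_ite, mul_zero, ← symComponent_mul_of_mem hf, symComponent_of_mem hg]
  · rw [if_pos h]
    exact symComponent_mem _ _
  · exact if_neg (not_le.2 h)

theorem eq_and_dvd_of_homogeneous_dvd {f g : CoordRing K V} {m n : ℕ}
    (hf : f ∈ homogeneousPart K V m) (hg : g ∈ homogeneousPart K V n) (hdvd : f ∣ g) (hg0 : g ≠ 0)
    (hnm : n ≤ m) : n = m ∧ g ∣ f := by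
  obtain ⟨q, rfl, hq_mem, hq_zero⟩ := exists_homogeneous_cofactor hf hg hdvd
  have hq0 : q ≠ 0 := right_ne_zero_of_mul hg0
  obtain rfl : n = m := hnm.eq_of_not_lt fun hlt => hq0 (hq_zero hlt)
  have hq_deg := hq_mem le_rfl
  rw [homogeneousPart, Nat.sub_self, pow_zero] at hq_deg
  obtain ⟨c, rfl⟩ := Submodule.mem_one.1 hq_deg
  have hc : IsUnit c := Ne.isUnit fun h => hq0 (by rw [h, map_zero])
  exact ⟨rfl, (hc.map (algebraMap K (CoordRing K V))).mul_right_dvd.2 dvd_rfl⟩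

variable {A : HyperplaneArrangement K V} {α : Dual K V} (hα : LinearMap.ker α ∈ A.hyperplanes)
  {ι : Type*} [Fintype ι]
  (b : Basis ι (CoordRing K V) (A.deletion (LinearMap.ker α)).derivationModule) {d : ι → ℕ}
  (hd : ∀ i, IsHomogeneousDerivation (b i).1 (d i)) {N : ℕ} {e : Multiset ℕ}
  (he : Multiset.map d Finset.univ.val = N ::ₘ e)
  (h'' : (A.restriction (LinearMap.ker α)).HasHomogeneousBasis e)

include hα hd he h''

theorem exists_le_not_dvd_of_deletion :
    ∃ i, d i ≤ N ∧ ¬ linForm α ∣ (b i).1 (linForm α) := by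
  by_contra! hdvd
  obtain ⟨n'', b'', d'', hd'', rfl⟩ := h''
  have hmem (i : {i // d i < N + 1}) : restrictDerivation (LinearMap.ker α) (b i.1).1 ∈
      (A.restriction (LinearMap.ker α)).derivationModule :=
    restrictDerivation_mem hα
      ((mem_derivationModule_iff_deletion hα).2 ⟨(b i.1).2, hdvd _ (Nat.lt_succ_iff.1 i.2)⟩)
  have hli := linearIndependent_restrictDerivation b (A.isCoatom _ hα) (fun h => h.2 rfl)
    (v := fun i : {i // d i < N + 1} => i.1) Subtype.val_injective
    fun i => hdvd _ (Nat.lt_succ_iff.1 i.2)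
  have hcard := card_le_card_filter_of_linearIndependent b'' hd'' (θ := fun i => ⟨_, hmem i⟩)
    (LinearIndependent.of_comp (Submodule.subtype _) hli)
    (fun i => (hd i.1).restrictDerivation _) Subtype.property
  rw [Fintype.card_subtype, ← countP_lt_map_univ, ← countP_lt_map_univ, he,
    Multiset.countP_cons_of_pos (p := (· < N + 1)) _ N.lt_succ_self] at hcard
  exact Nat.not_succ_le_self _ hcard

variable {B : CoordRing K (LinearMap.ker α)} (hB : B ∈ homogeneousPart K (LinearMap.ker α) N)
  (hdvd : ∀ θ ∈ (A.deletion (LinearMap.ker α)).derivationModule,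
    B ∣ restrictFun (LinearMap.ker α) (θ (linForm α)))

include hB hdvd

theorem exists_pivot_of_deletion :
    ∃ i, d i = N ∧ ¬ linForm α ∣ (b i).1 (linForm α) ∧ ∃ s : ι → CoordRing K V, s i = 1 ∧
      ∀ j, linForm α ∣ (b j).1 (linForm α) - (b i).1 (linForm α) * s j ∧
        IsHomogeneousDerivation (s j • (b i).1) (d j) := by
  have hdeg (j : ι) := restrictFun_mem_homogeneousPart (LinearMap.ker α) (hd j α)
  obtain ⟨i, hle, hi⟩ := exists_le_not_dvd_of_deletion hα b hd he h''
  have hi0 : restrictFun (LinearMap.ker α) ((b i).1 (linForm α)) ≠ 0 :=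
    mt restrictFun_eq_zero_iff.1 hi
  obtain ⟨rfl, hi_dvd⟩ :=
    eq_and_dvd_of_homogeneous_dvd hB (hdeg i) (hdvd _ (b i).2) hi0 hle
  choose q hq hq_mem hq_zero using fun j =>
    exists_homogeneous_cofactor (hdeg i) (hdeg j) (hi_dvd.trans (hdvd _ (b j).2))
  refine ⟨i, rfl, hi, fun j => extendFun (LinearMap.ker α) (q j), ?_, fun j => ⟨?_, ?_⟩⟩
  · have hqi : q i = 1 := mul_left_cancel₀ hi0 ((hq i).symm.trans (mul_one _).symm)
    simp only [hqi, map_one]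
  · rw [← restrictFun_eq_zero_iff, map_sub, map_mul, restrictFun_extendFun, sub_eq_zero]
    exact hq j
  · rcases le_or_gt (d i) (d j) with hij | hij
    · have hsmul := (hd i).smul (extendFun_mem_homogeneousPart (hq_mem j hij))
      rwa [Nat.sub_add_cancel hij] at hsmul
    · simp only [hq_zero j hij, map_zero, zero_smul]
      exact fun _ => zero_mem _

omit hB hdvd he hd h''

theorem HasHomogeneousBasis.addition
    (h' : (A.deletion (LinearMap.ker α)).HasHomogeneousBasis (N ::ₘ e))
    (h'' : (A.restriction (LinearMap.ker α)).HasHomogeneousBasis e)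
    (hB : B ∈ homogeneousPart K (LinearMap.ker α) N)
    (hdvd : ∀ θ ∈ (A.deletion (LinearMap.ker α)).derivationModule,
      B ∣ restrictFun (LinearMap.ker α) (θ (linForm α))) :
    A.HasHomogeneousBasis ((N + 1) ::ₘ e) := by
  obtain ⟨n, b, d, hd, he⟩ := h'
  obtain ⟨i, rfl, hi, s, hsi, hs⟩ := exists_pivot_of_deletion hα b hd he.symm h'' hB hdvd
  let φ := b.constr (CoordRing K V) s
  have φ_basis (j : Fin n) : φ (b j) = s j := b.constr_basis _ _ _
  have hprime := prime_linForm (A.isCoatom _ hα)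
  have mem_iff (θ : Derivation K (CoordRing K V) (CoordRing K V)) : θ ∈ A.derivationModule ↔
      ∃ h : θ ∈ (A.deletion (LinearMap.ker α)).derivationModule, linForm α ∣ φ ⟨θ, h⟩ := by
    rw [mem_derivationModule_iff_deletion hα, ← exists_prop]
    refine exists_congr fun h => ((dvd_iff_dvd_of_dvd_sub
      (linForm_dvd_sub_mul_constr b (fun j => (hs j).1) ⟨θ, h⟩)).trans ?_)
    exact ⟨fun hmul => (hprime.dvd_or_dvd hmul).resolve_left hi, fun hφ => hφ.mul_left _⟩
  obtain ⟨c, hci, hcj⟩ :=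
    exists_basis_of_mem_iff_dvd b ((φ_basis i).trans hsi) hprime.ne_zero mem_iff
  refine ⟨n, c, Function.update d i (d i + 1), fun j => ?_, (map_update_univ d i _ he.symm).symm⟩
  rcases eq_or_ne j i with rfl | hj
  · rw [hci, Function.update_self, add_comm]
    refine (hd j).smul ?_
    rw [homogeneousPart, pow_one]
    exact LinearMap.mem_range_self _ _
  · rw [hcj j hj, φ_basis, Function.update_of_ne hj]
    exact (hd j).sub (hs j).2

end Addition

section TeraoPolynomial

theorem isRelPrime_linForm {α β : Dual K V} (hα : IsCoatom (LinearMap.ker α))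
    (hβ : IsCoatom (LinearMap.ker β)) (hne : LinearMap.ker α ≠ LinearMap.ker β) :
    IsRelPrime (linForm α) (linForm β) :=
  (prime_linForm hα).irreducible.isRelPrime_iff_not_dvd.2 (not_linForm_dvd_linForm hα hβ hne)

theorem exists_smul_add_smul_eq_of_inf_ker_le {α₀ α β : Dual K V}
    (h : LinearMap.ker α₀ ⊓ LinearMap.ker α ≤ LinearMap.ker β)
    (hnle : ¬ LinearMap.ker α ≤ LinearMap.ker β) :
    ∃ x y : K, y ≠ 0 ∧ x • α + y • α₀ = β := by
  have hspan : β ∈ Submodule.span K {α, α₀} := by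
    have hrange : ({α, α₀} : Set (Dual K V)) = Set.range fun i => cond i α₀ α :=
      (Bool.range_eq fun i => cond i α₀ α).symm
    rw [hrange]
    exact mem_span_of_iInf_ker_le_ker (iInf_bool_eq.trans_le h)
  obtain ⟨x, y, rfl⟩ := Submodule.mem_span_pair.1 hspan
  refine ⟨x, y, ?_, rfl⟩
  rintro rfl
  rw [zero_smul, add_zero] at hnle
  exact hnle (LinearMap.ker_le_ker_smul _ _)

theorem linForm_dvd_sub_of_smul_add_smul_eq {θ : Derivation K (CoordRing K V) (CoordRing K V)}
    {α₀ α β : Dual K V} {x y : K} (hy : y ≠ 0) (hβ : x • α + y • α₀ = β) {g : CoordRing K V}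
    (hα : θ (linForm α) = linForm α * g) (hdvd : linForm β ∣ θ (linForm β)) :
    linForm β ∣ θ (linForm α₀) - linForm α₀ * g := by
  have hθβ : θ (linForm β) = linForm β * g + y • (θ (linForm α₀) - linForm α₀ * g) := by
    rw [← hβ, linForm, map_add, map_smul, map_smul, map_add, Derivation.map_smul,
      Derivation.map_smul, hα]
    simp only [Algebra.smul_def]
    ring
  rw [hθβ, dvd_add_right (dvd_mul_right _ _), Algebra.smul_def] at hdvd
  exact ((hy.isUnit.map (algebraMap K (CoordRing K V))).dvd_mul_left).1 hdvd

open Classical in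
/-- A linear form with kernel `H`, which exists if `H` is a hyperplane; zero otherwise. -/
noncomputable def definingForm (H : Submodule K V) : Dual K V :=
  if h : IsCoatom H then (exists_ker_eq_of_isCoatom h).choose else 0

theorem ker_definingForm {H : Submodule K V} (h : IsCoatom H) :
    LinearMap.ker (definingForm H) = H := by
  rw [definingForm, dif_pos h]
  exact (exists_ker_eq_of_isCoatom h).choose_spec

variable {A : HyperplaneArrangement K V} {α₀ : Dual K V}

theorem isCoatom_interIn_ker {H : Submodule K V} (hα₀ : IsCoatom (LinearMap.ker α₀))
    (hH : IsCoatom H) (hne : H ≠ LinearMap.ker α₀) : IsCoatom (interIn (LinearMap.ker α₀) H) :=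
  isCoatom_interIn hH fun hle => hne ((hα₀.le_iff_eq hH.1).1 hle)

theorem isRelPrime_restrictFun_definingForm {H H' : Submodule K V}
    (hα₀ : IsCoatom (LinearMap.ker α₀)) (hH : IsCoatom H) (hH' : IsCoatom H')
    (hne : H ≠ LinearMap.ker α₀) (hne' : H' ≠ LinearMap.ker α₀)
    (hinter : interIn (LinearMap.ker α₀) H ≠ interIn (LinearMap.ker α₀) H') :
    IsRelPrime (restrictFun (LinearMap.ker α₀) (linForm (definingForm H)))
      (restrictFun (LinearMap.ker α₀) (linForm (definingForm H'))) := by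
  have ker_dualRestrict {G : Submodule K V} (hG : IsCoatom G) :
      LinearMap.ker ((LinearMap.ker α₀).dualRestrict (definingForm G)) =
        interIn (LinearMap.ker α₀) G :=
    congrArg (interIn (LinearMap.ker α₀)) (ker_definingForm hG)
  rw [restrictFun_linForm, restrictFun_linForm]
  apply isRelPrime_linForm <;> simp only [ker_dualRestrict hH, ker_dualRestrict hH']
  exacts [isCoatom_interIn_ker hα₀ hH hne, isCoatom_interIn_ker hα₀ hH' hne', hinter]

theorem prod_restrictFun_definingForm_dvd_of_interIn_eq
    {θ : Derivation K (CoordRing K V) (CoordRing K V)} (hθ : θ ∈ A.derivationModule)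
    {L : Submodule K V} (hL : L ∈ A.hyperplanes) {F : Finset (Submodule K V)}
    (hF : (F : Set (Submodule K V)) ⊆ A.hyperplanes) (hLF : L ∉ F)
    (hinter : ∀ H ∈ F, interIn (LinearMap.ker α₀) H = interIn (LinearMap.ker α₀) L) :
    ∏ H ∈ F, restrictFun (LinearMap.ker α₀) (linForm (definingForm H)) ∣
      restrictFun (LinearMap.ker α₀) (θ (linForm α₀)) := by
  have ker_form {H : Submodule K V} (hH : H ∈ A.hyperplanes) :
      LinearMap.ker (definingForm H) = H := ker_definingForm (A.isCoatom H hH)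
  have isCoatom_ker {H : Submodule K V} (hH : H ∈ A.hyperplanes) :
      IsCoatom (LinearMap.ker (definingForm H)) := (ker_form hH).symm ▸ A.isCoatom H hH
  obtain ⟨g, hg⟩ := hθ L hL _ (ker_form hL)
  have hdvd : ∏ H ∈ F, linForm (definingForm H) ∣ θ (linForm α₀) - linForm α₀ * g := by
    refine Finset.prod_dvd_of_isRelPrime (fun H hH H' hH' hne => ?_) fun H hH => ?_
    · refine isRelPrime_linForm (isCoatom_ker (hF hH)) (isCoatom_ker (hF hH')) ?_
      rwa [ker_form (hF hH), ker_form (hF hH')]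
    · have hle : LinearMap.ker α₀ ⊓ L ≤ H :=
        (Submodule.comap_subtype_le_iff.1 (hinter H hH).ge).trans inf_le_right
      have hnle : ¬ L ≤ H := fun h => hLF
        (((A.isCoatom L hL).le_iff_eq (A.isCoatom H (hF hH)).1).1 h ▸ hH)
      rw [← ker_form hL, ← ker_form (hF hH)] at hle hnle
      obtain ⟨x, y, hy, hxy⟩ := exists_smul_add_smul_eq_of_inf_ker_le hle hnle
      exact linForm_dvd_sub_of_smul_add_smul_eq hy hxy hg (hθ H (hF hH) _ (ker_form (hF hH)))
  have hmap := map_dvd (restrictFun (LinearMap.ker α₀)) hdvd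
  rwa [map_prod, map_sub, map_mul, restrictFun_eq_zero_iff.2 dvd_rfl, zero_mul, sub_zero] at hmap

theorem exists_homogeneous_dvd_of_surjOn_interIn {B₀ : Set (Submodule K V)}
    (hB₀ : B₀ ⊆ A.hyperplanes) (hα₀ : LinearMap.ker α₀ ∈ B₀)
    (hsurj : Set.SurjOn (interIn (LinearMap.ker α₀)) (A.hyperplanes \ B₀)
      (A.restriction (LinearMap.ker α₀)).hyperplanes) :
    ∃ B ∈ homogeneousPart K (LinearMap.ker α₀) (B₀ \ {LinearMap.ker α₀}).ncard,
      ∀ θ ∈ (A.deletion (LinearMap.ker α₀)).derivationModule,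
        B ∣ restrictFun (LinearMap.ker α₀) (θ (linForm α₀)) := by
  classical
  set X := LinearMap.ker α₀
  have hX : IsCoatom X := A.isCoatom X (hB₀ hα₀)
  have hfin : (B₀ \ {X}).Finite := (A.finite.subset hB₀).subset Set.sdiff_subset
  set T := hfin.toFinset
  have hT : ∀ H ∈ T, H ∈ B₀ ∧ H ≠ X := fun H hH => hfin.mem_toFinset.1 hH
  have hTA : ∀ H ∈ T, IsCoatom H := fun H hH => A.isCoatom H (hB₀ (hT H hH).1)
  refine ⟨∏ H ∈ T, restrictFun X (linForm (definingForm H)), ?_, fun θ hθ => ?_⟩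
  · simp only [restrictFun_linForm]
    rw [Set.ncard_eq_toFinset_card _ hfin]
    exact prod_ι_mem_range_pow_card T _
  rw [← Finset.prod_fiberwise_of_maps_to fun H => Finset.mem_image_of_mem (interIn X)]
  refine Finset.prod_dvd_of_isRelPrime (fun Y _ Y' _ hne => ?_) fun Y hY => ?_
  · refine IsRelPrime.prod_left fun H hH => IsRelPrime.prod_right fun H' hH' => ?_
    obtain ⟨hHT, rfl⟩ := Finset.mem_filter.1 hH
    obtain ⟨hHT', rfl⟩ := Finset.mem_filter.1 hH'
    exact isRelPrime_restrictFun_definingForm hX (hTA H hHT) (hTA H' hHT') (hT H hHT).2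
      (hT H' hHT').2 hne
  · obtain ⟨H₁, hH₁, rfl⟩ := Finset.mem_image.1 hY
    have hmem : interIn X H₁ ∈ (A.restriction X).hyperplanes := mem_restriction.2
      ⟨H₁, hB₀ (hT H₁ hH₁).1, fun hle => (hT H₁ hH₁).2 ((hX.le_iff_eq (hTA H₁ hH₁).1).1 hle), rfl⟩
    obtain ⟨L, ⟨hLA, hLB⟩, hL⟩ := hsurj hmem
    refine prod_restrictFun_definingForm_dvd_of_interIn_eq hθ ⟨hLA, fun h => hLB (h ▸ hα₀)⟩ ?_
      (fun h => hLB (hT L (Finset.mem_filter.1 h).1).1)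
      fun H hH => (Finset.mem_filter.1 hH).2.trans hL.symm
    intro H hH
    obtain ⟨hHB, hHX⟩ := hT H (Finset.mem_filter.1 hH).1
    exact ⟨hB₀ hHB, hHX⟩

end TeraoPolynomial

section BlockSizes

variable {α β : Type*} {P : Set (Set α)} {s : Set α}

/-- The multiset of the sizes of the blocks of `P`. Up to zeros it is the multiset of exponents of
an arrangement with inductive factorization `P`. Defined by a `finsum`, it is empty for infinite
`P`. -/
noncomputable def blockSizes (P : Set (Set α)) : Multiset ℕ :=
  ∑ᶠ B ∈ P, {B.ncard}

theorem blockSizes_empty : blockSizes (∅ : Set (Set α)) = 0 :=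
  finsum_mem_empty

theorem blockSizes_insert {B : Set α} (hB : B ∉ P) (hP : P.Finite) :
    blockSizes (insert B P) = B.ncard ::ₘ blockSizes P := by
  rw [blockSizes, finsum_mem_insert _ hB hP, Multiset.singleton_add, blockSizes]

theorem blockSizes_eq_cons {B : Set α} (hB : B ∈ P) (hP : P.Finite) :
    blockSizes P = B.ncard ::ₘ blockSizes (P \ {B}) := by
  have notMem : B ∉ P \ {B} := fun h => h.2 rfl
  rw [← blockSizes_insert notMem hP.sdiff, Set.insert_sdiff_singleton,
    Set.insert_eq_of_mem hB]

theorem blockSizes_union {Q : Set (Set α)} (hPQ : Disjoint P Q) (hP : P.Finite) (hQ : Q.Finite) :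
    blockSizes (P ∪ Q) = blockSizes P + blockSizes Q :=
  finsum_mem_union hPQ hP hQ

theorem blockSizes_image {F : Set α → Set β} (hF : Set.InjOn F P)
    (h : ∀ B ∈ P, (F B).ncard = B.ncard) : blockSizes (F '' P) = blockSizes P := by
  rw [blockSizes, finsum_mem_image hF]
  exact finsum_mem_congr rfl fun B hB => by rw [h B hB]

theorem injOn_image_of_isPartitionOf (hP : IsPartitionOf P s) {B₀ : Set α} (hB₀ : B₀ ∈ P)
    {g : α → β} (hg : Set.InjOn g (s \ B₀)) :
    (∀ B ∈ P \ {B₀}, Set.InjOn g B) ∧ Set.InjOn (Set.image g) (P \ {B₀}) := by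
  have subset_sdiff : ∀ B ∈ P \ {B₀}, B ⊆ s \ B₀ := fun B hB a ha =>
    ⟨hP.subset hB.1 ha, fun ha₀ => hB.2 (hP.eq_of_mem hB.1 hB₀ ha ha₀)⟩
  exact ⟨fun B hB => hg.mono (subset_sdiff B hB), fun B hB C hC e =>
    (hg.image_eq_image_iff (subset_sdiff B hB) (subset_sdiff C hC)).1 e⟩

theorem inducedPartition_sdiff_singleton (hP : IsPartitionOf P s) {B₀ : Set α} (hB₀ : B₀ ∈ P)
    {a : α} (ha : a ∈ B₀) :
    inducedPartition P (s \ {a}) = {C | C.Nonempty ∧ C = B₀ \ {a}} ∪ P \ {B₀} := by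
  have inter_eq : ∀ B ∈ P, B ∩ (s \ {a}) = B \ {a} := fun B hB => by
    rw [← Set.inter_sdiff_assoc, Set.inter_eq_left.2 (hP.subset hB)]
  have sdiff_eq : ∀ B ∈ P, B ≠ B₀ → B \ {a} = B := fun B hB hne =>
    Set.sdiff_singleton_eq_self fun h => hne (hP.eq_of_mem hB hB₀ h ha)
  ext C
  constructor
  · rintro ⟨hne, B, hB, rfl⟩
    rw [inter_eq B hB] at hne ⊢
    by_cases e : B = B₀
    · exact Or.inl ⟨hne, by rw [e]⟩
    · exact Or.inr ((sdiff_eq B hB e).symm ▸ ⟨hB, e⟩)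
  · rintro (⟨hne, rfl⟩ | ⟨hC, hne⟩)
    · exact ⟨hne, B₀, hB₀, (inter_eq B₀ hB₀).symm⟩
    · exact ⟨hP.nonempty hC, C, hC, by rw [inter_eq C hC, sdiff_eq C hC hne]⟩

/- The zeros absorb the case `B₀ = {a}`, in which deleting `a` removes a block instead of
shrinking it. -/
theorem blockSizes_inducedPartition_sdiff_singleton (hP : IsPartitionOf P s) (hs : s.Finite)
    {B₀ : Set α} (hB₀ : B₀ ∈ P) {a : α} (ha : a ∈ B₀) {z z' : ℕ}
    (hz : z' + (inducedPartition P (s \ {a})).ncard = z + P.ncard) :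
    blockSizes (inducedPartition P (s \ {a})) + Multiset.replicate z' 0 =
      (B₀ \ {a}).ncard ::ₘ (blockSizes (P \ {B₀}) + Multiset.replicate z 0) := by
  have hPf := hP.finite hs
  have hcard := Set.ncard_sdiff_singleton_add_one hB₀ hPf
  rw [inducedPartition_sdiff_singleton hP hB₀ ha] at hz ⊢
  rcases (B₀ \ {a}).eq_empty_or_nonempty with hempty | hne
  · have no_block : {C | C.Nonempty ∧ C = B₀ \ {a}} = ∅ :=
      Set.eq_empty_of_forall_notMem fun C hC => hC.1.ne_empty (hC.2.trans hempty)
    rw [no_block, Set.empty_union] at hz ⊢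
    obtain rfl : z' = z + 1 := by omega
    rw [hempty, Set.ncard_empty, Multiset.replicate_succ, Multiset.add_cons]
  · have one_block : {C | C.Nonempty ∧ C = B₀ \ {a}} = {B₀ \ {a}} :=
      Set.ext fun C => and_iff_right_of_imp fun hC => hC ▸ hne
    have notMem : B₀ \ {a} ∉ P \ {B₀} := fun h =>
      hne.elim fun b hb => h.2 (hP.eq_of_mem h.1 hB₀ hb hb.1)
    rw [one_block, Set.singleton_union] at hz ⊢
    rw [Set.ncard_insert_of_notMem notMem hPf.sdiff] at hz
    obtain rfl : z' = z := by omega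
    rw [blockSizes_insert notMem hPf.sdiff, Multiset.cons_add]

end BlockSizes

section InductiveFreeness

theorem derivationModule_empty (K V : Type*) [Field K] [AddCommGroup V] [Module K V] :
    (HyperplaneArrangement.empty K V).derivationModule = ⊤ :=
  eq_top_iff.2 fun _ _ _ hH => hH.elim

theorem hasHomogeneousBasis_empty (K V : Type*) [Field K] [AddCommGroup V] [Module K V]
    [FiniteDimensional K V] :
    (HyperplaneArrangement.empty K V).HasHomogeneousBasis
      (Multiset.replicate (finrank K V) 0) := by
  let c := finBasis K (Dual K V)
  let e : (HyperplaneArrangement.empty K V).derivationModule ≃ₗ[CoordRing K V]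
      (Fin (finrank K (Dual K V)) → CoordRing K V) :=
    (LinearEquiv.ofTop _ (derivationModule_empty K V)).trans
      ((symDerivationEquiv K (Dual K V)).trans (c.constr (CoordRing K V)).symm)
  refine ⟨_, Basis.ofEquivFun e, fun _ => 0, fun i β => ?_, ?_⟩
  · have apply_linForm : (Basis.ofEquivFun e i).1 (linForm β) =
        c.constr (CoordRing K V) (Pi.single i 1) β := by
      rw [Basis.coe_ofEquivFun]
      exact symDerivation_ι _ _
    rw [apply_linForm, Basis.constr_apply_fintype, homogeneousPart, pow_zero]
    refine Submodule.sum_mem _ fun j _ => Submodule.smul_mem _ _ ?_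
    rcases eq_or_ne j i with rfl | hne
    · rw [Pi.single_eq_same]
      exact Submodule.one_le.1 le_rfl
    · rw [Pi.single_eq_of_ne hne]
      exact Submodule.zero_mem _
  · rw [Multiset.map_const', Finset.card_val, Finset.card_univ, Fintype.card_fin,
      Subspace.dual_finrank_eq]

theorem finrank_add_one_of_isCoatom [FiniteDimensional K V] {H : Submodule K V}
    (hH : IsCoatom H) : finrank K H + 1 = finrank K V := by
  rw [← H.finrank_quotient_add_finrank, finrank_quotient_of_isCoatom hH, add_comm]

theorem IsInductiveFactorization.exists_hasHomogeneousBasis {A : HyperplaneArrangement K V}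
    {P : Set (Set (Submodule K V))} (h : IsInductiveFactorization A P) :
    ∀ [FiniteDimensional K V], ∃ z, z + P.ncard = finrank K V ∧
      A.HasHomogeneousBasis (blockSizes P + Multiset.replicate z 0) := by
  induction h with
  | empty V =>
    intro _
    refine ⟨finrank K V, by rw [Set.ncard_empty, add_zero], ?_⟩
    rw [blockSizes_empty, zero_add]
    exact hasHomogeneousBasis_empty K V
  | step A P hP B₀ hB₀ H₀ hH₀ bijective _ _ deletion_basis restriction_basis =>
    intro _
    have hH₀A := hP.subset hB₀ hH₀
    have dim_H₀ := finrank_add_one_of_isCoatom (A.isCoatom _ hH₀A)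
    have card_P := Set.ncard_sdiff_singleton_add_one hB₀ (hP.finite A.finite)
    obtain ⟨z', hz', hdel⟩ := deletion_basis
    obtain ⟨z, hz, hres⟩ := restriction_basis
    obtain ⟨α, rfl⟩ := exists_ker_eq_of_isCoatom (A.isCoatom _ hH₀A)
    obtain ⟨B, hB, hdvd⟩ :=
      exists_homogeneous_dvd_of_surjOn_interIn (hP.subset hB₀) hH₀ bijective.surjOn
    obtain ⟨injOn_block, injOn_image⟩ := injOn_image_of_isPartitionOf hP hB₀ bijective.injOn
    rw [injOn_image.ncard_image] at hz
    rw [blockSizes_image injOn_image fun C hC => (injOn_block C hC).ncard_image] at hres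
    have exponents_deletion := blockSizes_inducedPartition_sdiff_singleton hP A.finite hB₀ hH₀
      (z := z) (hz'.trans (by omega))
    refine ⟨z, by omega, ?_⟩
    rw [blockSizes_eq_cons hB₀ (hP.finite A.finite), Multiset.cons_add,
      ← Set.ncard_sdiff_singleton_add_one hH₀ (A.finite.subset (hP.subset hB₀))]
    exact HasHomogeneousBasis.addition hH₀A (exponents_deletion ▸ hdel) hres hB hdvd

variable {V₁ V₂ : Type*} [AddCommGroup V₁] [Module K V₁] [AddCommGroup V₂] [Module K V₂]
  {A₁ : HyperplaneArrangement K V₁} {A₂ : HyperplaneArrangement K V₂}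
  {P₁ : Set (Set (Submodule K V₁))} {P₂ : Set (Set (Submodule K V₂))}

theorem blockSizes_gluePartition {f₁ : V →ₗ[K] V₁} {f₂ : V →ₗ[K] V₂}
    (hf : Function.Surjective (f₁.prod f₂))
    (h₁ : IsPartitionOf P₁ A₁.hyperplanes) (h₂ : IsPartitionOf P₂ A₂.hyperplanes) :
    blockSizes (gluePartition P₁ P₂ f₁ f₂) = blockSizes P₁ + blockSizes P₂ := by
  have inj₁ := comap_fst_injective hf
  have inj₂ := comap_snd_injective hf
  rw [gluePartition, blockSizes_union (disjoint_image_partition hf P₁ h₂)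
      ((h₁.finite A₁.finite).image _) ((h₂.finite A₂.finite).image _),
    blockSizes_image (Set.image_injective.2 inj₁).injOn
      fun B _ => Set.ncard_image_of_injective B inj₁,
    blockSizes_image (Set.image_injective.2 inj₂).injOn
      fun B _ => Set.ncard_image_of_injective B inj₂]

theorem exists_isFreeWithExponents_prod [FiniteDimensional K V₁] [FiniteDimensional K V₂]
    (h₁ : A₁.IsInductivelyFactored) (h₂ : A₂.IsInductivelyFactored) :
    ∃ e₁ e₂ : Multiset ℕ, A₁.IsFreeWithExponents e₁ ∧ A₂.IsFreeWithExponents e₂ ∧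
      (A₁.prod A₂).IsFreeWithExponents (e₁ + e₂) := by
  obtain ⟨P₁, hP₁⟩ := h₁
  obtain ⟨P₂, hP₂⟩ := h₂
  have hf := surjective_fst_prod_snd K V₁ V₂
  obtain ⟨z₁, hz₁, basis₁⟩ := hP₁.exists_hasHomogeneousBasis
  obtain ⟨z₂, hz₂, basis₂⟩ := hP₂.exists_hasHomogeneousBasis
  obtain ⟨z, hz, basis⟩ := (hP₁.glue hP₂ hf).exists_hasHomogeneousBasis
  rw [ncard_gluePartition hf hP₁.isPartitionOf hP₂.isPartitionOf, finrank_prod] at hz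
  obtain rfl : z = z₁ + z₂ := by omega
  rw [blockSizes_gluePartition hf hP₁.isPartitionOf hP₂.isPartitionOf, Multiset.replicate_add,
    add_add_add_comm, ← prod_eq_glue] at basis
  exact ⟨_, _, basis₁.isFreeWithExponents, basis₂.isFreeWithExponents, basis.isFreeWithExponents⟩

end InductiveFreeness

end HyperplaneArrangement

open HyperplaneArrangement in
theorem mainTheorem8_general {K : Type w} [Field K] {V₁ : Type u} {V₂ : Type v}
    [AddCommGroup V₁] [Module K V₁] [AddCommGroup V₂] [Module K V₂]
    (A₁ : HyperplaneArrangement K V₁) (A₂ : HyperplaneArrangement K V₂) :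
    ((A₁.prod A₂).IsHereditarilyFactored ↔
      A₁.IsHereditarilyFactored ∧ A₂.IsHereditarilyFactored) ∧
    ((A₁.prod A₂).IsHereditarilyInductivelyFactored ↔
      A₁.IsHereditarilyInductivelyFactored ∧ A₂.IsHereditarilyInductivelyFactored) ∧
    (∀ [FiniteDimensional K V₁] [FiniteDimensional K V₂], (A₁.prod A₂).IsInductivelyFactored →
      ∃ e₁ e₂ : Multiset ℕ, A₁.IsFreeWithExponents e₁ ∧ A₂.IsFreeWithExponents e₂ ∧
        (A₁.prod A₂).IsFreeWithExponents (e₁ + e₂)) := by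
  refine ⟨?_, ?_, fun h => ?_⟩
  · rw [prod_eq_glue]
    exact isHereditarilyFactored_glue_iff _
  · rw [prod_eq_glue]
    exact isHereditarilyInductivelyFactored_glue_iff _
  · rw [prod_eq_glue, isInductivelyFactored_glue_iff] at h
    exact exists_isFreeWithExponents_prod h.1 h.2

theorem mainTheorem8 {K : Type w} [Field K] {V₁ : Type u} {V₂ : Type v}
    [AddCommGroup V₁] [Module K V₁] [FiniteDimensional K V₁]
    [AddCommGroup V₂] [Module K V₂] [FiniteDimensional K V₂]
    (A₁ : HyperplaneArrangement K V₁) (A₂ : HyperplaneArrangement K V₂) :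
    ((A₁.prod A₂).IsHereditarilyFactored ↔
      A₁.IsHereditarilyFactored ∧ A₂.IsHereditarilyFactored) ∧
    ((A₁.prod A₂).IsHereditarilyInductivelyFactored ↔
      A₁.IsHereditarilyInductivelyFactored ∧ A₂.IsHereditarilyInductivelyFactored) ∧
    ((A₁.prod A₂).IsInductivelyFactored →
      ∃ e₁ e₂ : Multiset ℕ, A₁.IsFreeWithExponents e₁ ∧ A₂.IsFreeWithExponents e₂ ∧
        (A₁.prod A₂).IsFreeWithExponents (e₁ + e₂)) :=
  (mainTheorem8_general A₁ A₂).imp_right fun h => ⟨h.1, h.2⟩
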